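/- Let $E\neq\{0\}$ be an order continuous Banach lattice (every net decreasing in order to $0$ converges in norm to $0$) with a weak unit, i.e. a vector $e\in E$, $e\ge 0$, such that $\||x|\wedge e\|=0$ implies $x=0$. A \emph{representation} of $E$ as a Köthe function space consists of a probability space $(\Omega,\Sigma,\mu)$ and an identification of $E$ with a linear subspace of $L_1(\mu)$ such that $L_\infty(\mu)\subset E\subset L_1(\mu)$, $E$ is dense in $L_1(\mu)$, $L_\infty(\mu)$ is dense in $E$, $\|f\|_1\le\|f\|_E\le 2\|f\|_\infty$ for all $f\in L_\infty(\mu)$, and the order of $E$ is the one induced by $L_1(\mu)$. Such a representation exists. Fix any one of them, and for $x\in E$ put $\operatorname{supp} x=\{t\in\Omega : x(t)\ne 0\}$. Let $S_E=\{x\in E:\|x\|=1\}$, let $Y$ be a Banach space and let $T:E\to Y$ be a continuous linear operator. Then the following assertions are equivalent: 1. $T$ is disjointly non-singular: there is no sequence $(x_n)$ of pairwise disjoint non-zero vectors of $E$ such that the restriction of $T$ to the closed linear span $[x_n]$ is strictly singular (an operator is strictly singular if its restriction to no closed infinite dimensional subspace is an isomorphism onto its range). 2. There exists $r>0$ such that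 for every sequence $(x_n)$ in $S_E$ with $\lim_{n\to\infty}\mu(\operatorname{supp} x_n)=0$ one has $\liminf_{n\to\infty}\|Tx_n\|>r$. 3. For every sequence $(x_n)$ in $S_E$ with $\lim_{n\to\infty}\mu(\operatorname{supp} x_n)=0$ one has $\liminf_{n\to\infty}\|Tx_n\|>0$. 4. There exists $r>0$ such that $\|Tx\|>r$ for every $x\in S_E$ with $\mu(\operatorname{supp} x)<r$. -/

import Mathlib

open MeasureTheory Filter Topology
open scoped ENNReal

universe u v w

section BanachLattice

variable {E : Type u} [NormedAddCommGroup E] [Lattice E]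

/-- The norm of `E` is order continuous: every net decreasing in order to `0` converges in norm
to `0`. (The range of such a net is a downward directed subset of `E`, so index types in the
universe of `E` give all of them.) -/
def OrderContinuousNorm (E : Type u) [NormedAddCommGroup E] [Lattice E] : Prop :=
  ∀ (ι : Type u) [Preorder ι] [IsDirectedOrder ι] [Nonempty ι] (x : ι → E),
    Antitone x → IsGLB (Set.range x) 0 → Tendsto x atTop (𝓝 0)

/-- `e ≥ 0` is a weak unit if `‖|x| ∧ e‖ = 0` implies `x = 0`. -/
def IsWeakUnit (e : E) : Prop :=
  0 ≤ e ∧ ∀ x : E, ‖|x| ⊓ e‖ = 0 → x = 0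

/-- A sequence of pairwise disjoint non-zero vectors. -/
def IsDisjointSeq (x : ℕ → E) : Prop :=
  (∀ n, x n ≠ 0) ∧ ∀ m n, m ≠ n → |x m| ⊓ |x n| = 0

end BanachLattice

section Operators

variable {X : Type u} {Y : Type v} [NormedAddCommGroup X] [NormedSpace ℝ X]
  [NormedAddCommGroup Y] [NormedSpace ℝ Y]

/-- `T` is an isomorphism onto its range, that is, bounded below. -/
def IsIsomorphismInto (T : X →L[ℝ] Y) : Prop :=
  ∃ c : ℝ, 0 < c ∧ ∀ x : X, c * ‖x‖ ≤ ‖T x‖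

/-- `T` is strictly singular: its restriction to no closed infinite dimensional subspace is an
isomorphism. -/
def IsStrictlySingular (T : X →L[ℝ] Y) : Prop :=
  ¬ ∃ M : Submodule ℝ X, IsClosed (M : Set X) ∧ ¬ FiniteDimensional ℝ M ∧
    IsIsomorphismInto (T.comp M.subtypeL)

/-- The closed subspace `[x_n]` generated by a sequence. -/
def closedSpan (x : ℕ → X) : Submodule ℝ X :=
  (Submodule.span ℝ (Set.range x)).topologicalClosure

/-- `T` is disjointly non-singular: there is no disjoint sequence `(x_n)` of non-zero vectors such
that the restriction of `T` to `[x_n]` is strictly singular. -/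
def IsDisjointlyNonSingular [Lattice X] (T : X →L[ℝ] Y) : Prop :=
  ¬ ∃ x : ℕ → X, IsDisjointSeq x ∧ IsStrictlySingular (T.comp (closedSpan x).subtypeL)

end Operators

/-- A representation of the Banach lattice `E` as a Köthe function space over `(Ω, μ)`:
`μ` is a probability measure and, identifying `E` with its image under `toL1`,
`L_∞(μ) ⊆ E ⊆ L_1(μ)` with `E` dense in `L_1(μ)` and `L_∞(μ)` dense in `E`,
`‖f‖_1 ≤ ‖f‖_E ≤ 2 ‖f‖_∞` for `f ∈ L_∞(μ)`, and the order of `E` is induced by `L_1(μ)`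
(in particular `toL1` is injective). -/
structure KotheRepresentation (E : Type u) [NormedAddCommGroup E] [NormedSpace ℝ E] [Lattice E]
    {Ω : Type w} [MeasurableSpace Ω] (μ : Measure Ω) where
  isProbabilityMeasure : IsProbabilityMeasure μ
  toL1 : E →ₗ[ℝ] Lp ℝ 1 μ
  le_iff_le : ∀ x y : E, toL1 x ≤ toL1 y ↔ x ≤ y
  linfty_subset : ∀ f : Lp ℝ 1 μ, MemLp f ∞ μ → f ∈ Set.range toL1
  dense_range : DenseRange toL1
  dense_linfty : Dense {x : E | MemLp (toL1 x) ∞ μ}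
  norm_toL1_le : ∀ x : E, MemLp (toL1 x) ∞ μ → ‖toL1 x‖ ≤ ‖x‖
  norm_le_two_mul : ∀ x : E, MemLp (toL1 x) ∞ μ → ‖x‖ ≤ 2 * (eLpNorm (toL1 x) ∞ μ).toReal

/-- The support `{t ∈ Ω : x(t) ≠ 0}` of `x ∈ E`, defined up to a `μ`-null set. -/
def KotheRepresentation.supp {E : Type u} [NormedAddCommGroup E] [NormedSpace ℝ E] [Lattice E]
    {Ω : Type w} [MeasurableSpace Ω] {μ : Measure Ω} (R : KotheRepresentation E μ) (x : E) :
    Set Ω :=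
  {t | R.toL1 x t ≠ 0}

set_option linter.unusedSectionVars false

/-! ### Order completeness from order continuity of the norm -/

section OrderContinuity

variable {E : Type u} [NormedAddCommGroup E] [NormedSpace ℝ E] [Lattice E]
  [IsOrderedAddMonoid E] [HasSolidNorm E]

/-! Existence of a representation. Order continuity makes `E` order complete, with infima of
directed sets attained as norm limits of sequences. Hence countably many positive functionals can be
summed to a strictly positive one (`exists_strictlyPositive`), normalized against a weak unit `e`.
The ideal generated by `e` is a vector lattice with order unit. Its normalized lattice homomorphisms
to `ℝ` form a compact space `K`; extreme states are such homomorphisms, so Krein-Milman,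
Stone-Weierstrass and Riesz turn `φ` into integration against a probability measure on `K`. Then `φ
|x|` is the `L¹` norm of the image of `x`, and the map extends from the dense ideal to `E`. Bounded
functions lie in the range because sequences in an order interval that are rapidly Cauchy for `φ
|x|` have limits there, built as limits superior (`exists_limit_of_bounded`).

The equivalences. In any representation the lattice operations are pointwise, multiplication by an
indicator is a contraction, and the norm of each vector is absolutely continuous with respect to `μ`
(`exists_norm_restrict_le`). If (4) holds, a tail of a disjoint sequence lives on a set of measure
less than `r`, so `T` is bounded below on the closed span of that tail, and (1) follows. If (4)
fails, choose unit vectors whose supports and images shrink so fast that deleting from each one its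
part on all later supports changes it little. The result is a disjoint sequence, bounded away from
zero, with summable images; since the coordinate projections are contractive, `T` is strictly
singular on its closed span (`isStrictlySingular_of_summable`), contradicting (1). Conditions (2)
and (3) are the sequential forms of (4). -/

theorem norm_le_norm_of_nonneg_of_le {x y : E} (hx : 0 ≤ x) (hxy : x ≤ y) : ‖x‖ ≤ ‖y‖ :=
  norm_le_norm_of_abs_le_abs (by rwa [abs_of_nonneg hx, abs_of_nonneg (hx.trans hxy)])

/-- A normed vector lattice is Archimedean. -/
theorem eq_zero_of_forall_nsmul_le {z b : E} (hz : 0 ≤ z) (h : ∀ n : ℕ, n • z ≤ b) : z = 0 := by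
  rw [← norm_le_zero_iff]
  refine le_of_forall_pos_le_add fun ε hε => ?_
  obtain ⟨n, hn⟩ := exists_nat_gt (‖b‖ / ε)
  have h1 : ‖n • z‖ ≤ ‖b‖ := norm_le_norm_of_nonneg_of_le (nsmul_nonneg hz n) (h n)
  rw [← Nat.cast_smul_eq_nsmul ℝ, norm_smul, Real.norm_natCast] at h1
  have h2 : ‖b‖ < n * ε := (div_lt_iff₀ hε).1 hn
  have h3 : (0 : ℝ) ≤ n := n.cast_nonneg
  by_contra! h4
  nlinarith [norm_nonneg b, mul_nonneg h3 (sub_nonneg.2 h4.le)]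

/-- The set `D`, indexed by itself with the order reversed, is a decreasing net. -/
theorem OrderContinuousNorm.zero_mem_closure (hE : OrderContinuousNorm E) {D : Set E}
    (hne : D.Nonempty) (hd : DirectedOn (· ≥ ·) D) (h0 : IsGLB D 0) : (0 : E) ∈ closure D := by
  let ι := (↥D)ᵒᵈ
  have : Nonempty ι := hne.to_subtype
  have : IsDirectedOrder ι := ⟨fun a b => by
    obtain ⟨c, hc, h1, h2⟩ := hd a.ofDual.1 a.ofDual.2 b.ofDual.1 b.ofDual.2
    exact ⟨OrderDual.toDual ⟨c, hc⟩, h1, h2⟩⟩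
  have h := hE ι (fun i => (OrderDual.ofDual i).1) (fun a b hab => hab) (by
    convert h0
    ext y
    constructor
    · rintro ⟨i, rfl⟩; exact (OrderDual.ofDual i).2
    · intro hy; exact ⟨OrderDual.toDual ⟨y, hy⟩, rfl⟩)
  exact mem_closure_of_tendsto h (Eventually.of_forall fun i => (OrderDual.ofDual i).2)

/-- Order continuous Banach lattices are order complete, and infima of directed sets are norm
limits. -/
theorem OrderContinuousNorm.exists_isGLB [CompleteSpace E] (hE : OrderContinuousNorm E) {D : Set E}
    (hne : D.Nonempty) (hd : DirectedOn (· ≥ ·) D) (hb : BddBelow D) :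
    ∃ z ∈ closure D, IsGLB D z := by
  let W : Set E := {w | ∃ x ∈ D, ∃ y ∈ lowerBounds D, w = x - y}
  have hW0 : IsGLB W 0 := by
    refine ⟨?_, fun z hz => ?_⟩
    · rintro _ ⟨x, hx, y, hy, rfl⟩
      exact sub_nonneg.2 (hy hx)
    -- A lower bound `z` of all differences can be added repeatedly to any lower bound of `D`, in
    -- the form `z⁺`; since `E` is Archimedean this forces `z⁺ = 0`.
    · have key : ∀ n : ℕ, ∀ y ∈ lowerBounds D, y + n • z⁺ ∈ lowerBounds D := by
        intro n
        induction n with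
        | zero => intro y hy; simpa using hy
        | succ n ih =>
          intro y hy x hx
          have h1 : z ≤ x - (y + n • z⁺) := hz ⟨x, hx, _, ih y hy, rfl⟩
          have h2 : z⁺ ≤ x - (y + n • z⁺) := by
            rw [posPart_def]
            exact sup_le h1 (sub_nonneg.2 (ih y hy hx))
          rw [succ_nsmul, ← add_assoc]
          rw [le_sub_iff_add_le] at h2
          rwa [add_comm]
      obtain ⟨y, hy⟩ := hb
      obtain ⟨x, hx⟩ := hne
      have : z⁺ = 0 := eq_zero_of_forall_nsmul_le (b := x - y) (posPart_nonneg z) fun n => by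
        rw [le_sub_iff_add_le, add_comm]
        exact key n y hy hx
      rw [← this]
      exact le_posPart z
  have hWd : DirectedOn (· ≥ ·) W := by
    rintro _ ⟨x, hx, y, hy, rfl⟩ _ ⟨x', hx', y', hy', rfl⟩
    obtain ⟨c, hc, h1, h2⟩ := hd x hx x' hx'
    exact ⟨c - (y ⊔ y'), ⟨c, hc, _, fun d hd => sup_le (hy hd) (hy' hd), rfl⟩,
      sub_le_sub h1 le_sup_left, sub_le_sub h2 le_sup_right⟩
  have hWne : W.Nonempty := by
    obtain ⟨y, hy⟩ := hb
    obtain ⟨x, hx⟩ := hne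
    exact ⟨_, x, hx, y, hy, rfl⟩
  have h0 := hE.zero_mem_closure hWne hWd hW0
  rw [Metric.mem_closure_iff] at h0
  have h1 : ∀ n : ℕ, ∃ x ∈ D, ∃ y ∈ lowerBounds D, ‖x - y‖ < 1 / ((n : ℝ) + 1) := fun n => by
    obtain ⟨_, ⟨x, hx, y, hy, rfl⟩, h⟩ := h0 (1 / ((n : ℝ) + 1)) (by positivity)
    exact ⟨x, hx, y, hy, by simpa [dist_eq_norm, norm_sub_rev] using h⟩
  choose x hx y hy hxy using h1
  have hlim : Tendsto (fun n : ℕ => 1 / ((n : ℝ) + 1)) atTop (𝓝 0) :=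
    tendsto_one_div_add_atTop_nhds_zero_nat
  have hc : CauchySeq x := by
    refine cauchySeq_of_le_tendsto_0 (fun n => 1 / ((n : ℝ) + 1) + 1 / ((n : ℝ) + 1)) ?_
      (by simpa using hlim.add hlim)
    -- The sequence `x` need not be monotone: two terms are compared through a common lower element
    -- `c` of `D`, squeezed between `y n` and `x n`.
    have aux : ∀ n, ∀ c ∈ D, c ≤ x n → ‖x n - c‖ ≤ 1 / ((n : ℝ) + 1) := fun n c hc hcn =>
      (norm_le_norm_of_nonneg_of_le (sub_nonneg.2 hcn)
        (sub_le_sub_left (hy n hc) _)).trans (hxy n).le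
    intro n m N hn hm
    obtain ⟨c, hc, hcn, hcm⟩ := hd _ (hx n) _ (hx m)
    have e : x n - x m = (x n - c) - (x m - c) := by abel
    rw [dist_eq_norm, e]
    refine (norm_sub_le _ _).trans (add_le_add ((aux n c hc hcn).trans ?_)
      ((aux m c hc hcm).trans ?_))
    · exact Nat.one_div_le_one_div hn
    · exact Nat.one_div_le_one_div hm
  obtain ⟨z, hz⟩ := cauchySeq_tendsto_of_complete hc
  have hz' : Tendsto y atTop (𝓝 z) := by
    have : Tendsto (fun n => x n - y n) atTop (𝓝 0) :=
      squeeze_zero_norm (fun n => (hxy n).le) hlim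
    simpa using hz.sub this
  refine ⟨z, mem_closure_of_tendsto hz (Eventually.of_forall hx), ?_, ?_⟩
  · intro d hd
    exact le_of_tendsto' hz' fun n => hy n hd
  · intro d hd
    exact ge_of_tendsto' hz fun n => hd (hx n)

theorem OrderContinuousNorm.exists_isLUB [CompleteSpace E] (hE : OrderContinuousNorm E) {D : Set E}
    (hne : D.Nonempty) (hd : DirectedOn (· ≤ ·) D) (hb : BddAbove D) :
    ∃ z ∈ closure D, IsLUB D z := by
  obtain ⟨z, hz, hz'⟩ := hE.exists_isGLB (D := -D) hne.neg (by
    intro a ha b hb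
    obtain ⟨c, hc, h1, h2⟩ := hd _ ha _ hb
    exact ⟨-c, by simpa using hc, neg_le.1 h1, neg_le.1 h2⟩) hb.neg
  refine ⟨-z, ?_, ?_⟩
  · have := neg_closure (-D)
    rw [neg_neg] at this
    rw [← this]; simpa using hz
  · simpa using hz'.neg

theorem OrderContinuousNorm.tendsto_of_antitone [CompleteSpace E] (hE : OrderContinuousNorm E)
    {x : ℕ → E} (hx : Antitone x) {b : E} (hb : ∀ n, b ≤ x n) :
    ∃ z, Tendsto x atTop (𝓝 z) := by
  obtain ⟨z, hz, hz'⟩ := hE.exists_isGLB (D := Set.range x) (Set.range_nonempty x)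
    (by
      rintro _ ⟨n, rfl⟩ _ ⟨m, rfl⟩
      exact ⟨_, ⟨max n m, rfl⟩, hx (le_max_left _ _), hx (le_max_right _ _)⟩)
    ⟨b, by rintro _ ⟨n, rfl⟩; exact hb n⟩
  refine ⟨z, Metric.tendsto_atTop.2 fun ε hε => ?_⟩
  obtain ⟨_, ⟨N, rfl⟩, hN⟩ := Metric.mem_closure_iff.1 hz ε hε
  refine ⟨N, fun n hn => lt_of_le_of_lt ?_ hN⟩
  rw [dist_comm z, dist_eq_norm, dist_eq_norm]
  exact norm_le_norm_of_nonneg_of_le (sub_nonneg.2 (hz'.1 ⟨n, rfl⟩)) (sub_le_sub_right (hx hn) _)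

theorem OrderContinuousNorm.tendsto_of_monotone [CompleteSpace E] (hE : OrderContinuousNorm E)
    {x : ℕ → E} (hx : Monotone x) {b : E} (hb : ∀ n, x n ≤ b) :
    ∃ z, Tendsto x atTop (𝓝 z) := by
  obtain ⟨z, hz⟩ := hE.tendsto_of_antitone (x := -x) hx.neg (b := -b) fun n => neg_le_neg (hb n)
  exact ⟨-z, by simpa using hz.neg⟩

/-- If `e` is a weak unit, then `x ⊓ n e` converges to `x` for `x ≥ 0`. -/
theorem OrderContinuousNorm.tendsto_inf_nsmul (hE : OrderContinuousNorm E) [CompleteSpace E] {e : E}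
    (he : IsWeakUnit e) {x : E} (hx : 0 ≤ x) :
    Tendsto (fun n : ℕ => x ⊓ n • e) atTop (𝓝 x) := by
  have hmono : Monotone fun n : ℕ => x ⊓ n • e := fun n m hnm =>
    inf_le_inf_left _ (nsmul_le_nsmul_left he.1 hnm)
  obtain ⟨z, hz⟩ := hE.tendsto_of_monotone hmono (b := x) fun n => inf_le_left
  have hzx : z ≤ x := le_of_tendsto' hz fun n => inf_le_left
  have hzn : ∀ n : ℕ, x ⊓ n • e ≤ z := hmono.ge_of_tendsto hz
  have hd : 0 ≤ x - z := sub_nonneg.2 hzx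
  have hw0 : 0 ≤ (x - z) ⊓ e := le_inf hd he.1
  -- If the limit `z` fell short of `x`, the part of the gap below `e` could be added at every step
  -- without exceeding `x`, contrary to the Archimedean property.
  have key : ∀ n : ℕ, n • ((x - z) ⊓ e) ≤ x ⊓ n • e := by
    intro n
    induction n with
    | zero => simpa using hx
    | succ n ih =>
      rw [succ_nsmul, succ_nsmul]
      refine le_inf ?_ (add_le_add (ih.trans inf_le_right) inf_le_right)
      calc _ ≤ z + (x - z) := add_le_add (ih.trans (hzn n)) inf_le_left
        _ = x := by abel
  have h0 := eq_zero_of_forall_nsmul_le hw0 fun n => (key n).trans inf_le_left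
  have : x - z = 0 := he.2 _ (by rw [abs_of_nonneg hd, h0, norm_zero])
  rwa [← sub_eq_zero.1 this] at hz

end OrderContinuity

/-! ### Strictly positive functionals -/

section PositiveFunctionals

theorem smul_posPart_of_pos {V : Type*} [AddCommGroup V] [Module ℝ V] [Lattice V]
    [IsOrderedAddMonoid V] [IsOrderedModule ℝ V] {c : ℝ} (hc : 0 < c) (x : V) :
    (c • x)⁺ = c • x⁺ := by
  rw [posPart_def, posPart_def]
  have h : c • (x ⊔ 0) = c • x ⊔ c • (0 : V) := (OrderIso.smulRight (β := V) hc).map_sup x 0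
  rw [h, smul_zero]

variable {E : Type u} [NormedAddCommGroup E] [NormedSpace ℝ E] [Lattice E]
  [IsOrderedAddMonoid E] [IsOrderedModule ℝ E] [HasSolidNorm E]

theorem norm_posPart_le (x : E) : ‖x⁺‖ ≤ ‖x‖ := by
  rw [← norm_abs_eq_norm x]
  exact norm_le_norm_of_nonneg_of_le (posPart_nonneg x) (sup_le (le_abs_self x) (abs_nonneg x))

theorem posPart_add_le_posPart_add (x y : E) : (x + y)⁺ ≤ x⁺ + y⁺ := by
  rw [posPart_def (x + y)]
  exact sup_le (add_le_add (le_posPart x) (le_posPart y))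
    (add_nonneg (posPart_nonneg x) (posPart_nonneg y))

/-- Every positive vector is normed by a positive functional. -/
theorem exists_positive_functional_norming {q : E} (hq : 0 ≤ q) (hq0 : q ≠ 0) :
    ∃ ψ : E →L[ℝ] ℝ, (∀ x, 0 ≤ x → 0 ≤ ψ x) ∧ (∀ x, |ψ x| ≤ ‖x‖) ∧ ψ q = ‖q‖ := by
  -- Dominating by `‖x⁺‖` instead of `‖x‖` makes the Hahn-Banach extension positive, because `(-x)⁺
  -- = 0` for `x ≥ 0`.
  obtain ⟨g, hg, hg'⟩ := exists_extension_of_le_sublinear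
    (LinearPMap.mkSpanSingleton q ‖q‖ hq0) (fun x => ‖x⁺‖)
    (fun c hc x => by
      simp only [smul_posPart_of_pos hc, norm_smul, Real.norm_of_nonneg hc.le])
    (fun x y => (norm_le_norm_of_nonneg_of_le (posPart_nonneg _)
      (posPart_add_le_posPart_add x y)).trans (norm_add_le _ _))
    (by
      rintro ⟨x, hx⟩
      obtain ⟨c, rfl⟩ := Submodule.mem_span_singleton.1 hx
      have hval : LinearPMap.mkSpanSingleton q ‖q‖ hq0 ⟨c • q, hx⟩ = c * ‖q‖ :=
        LinearPMap.mkSpanSingleton'_apply _ _ _ _ _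
      rw [hval]
      rcases le_or_gt c 0 with hc | hc
      · exact (mul_nonpos_of_nonpos_of_nonneg hc (norm_nonneg q)).trans (norm_nonneg _)
      · simp only [smul_posPart_of_pos hc, norm_smul, Real.norm_of_nonneg hc.le,
          posPart_eq_self.2 hq, le_refl])
  have hle : ∀ x, g x ≤ ‖x‖ := fun x => (hg' x).trans (norm_posPart_le x)
  have habs : ∀ x, |g x| ≤ ‖x‖ := fun x => abs_le'.2 ⟨hle x, by
    simpa using hle (-x)⟩
  refine ⟨g.mkContinuous 1 fun x => by simpa using habs x, fun x hx => ?_, habs, ?_⟩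
  · have := hg' (-x)
    rw [posPart_eq_zero.2 (neg_nonpos.2 hx), norm_zero, map_neg] at this
    simpa using this
  · have := hg ⟨q, Submodule.mem_span_singleton_self q⟩
    rw [LinearPMap.mkSpanSingleton_apply] at this
    simpa using this

/-- The largest vector of the order interval `[0, e]` on which a positive functional vanishes. -/
theorem OrderContinuousNorm.exists_isGreatest_null [CompleteSpace E] (hE : OrderContinuousNorm E)
    {e : E} (he : 0 ≤ e) (ψ : E →L[ℝ] ℝ) (hψ : ∀ x, 0 ≤ x → 0 ≤ ψ x) :
    ∃ q, IsGreatest {x | 0 ≤ x ∧ x ≤ e ∧ ψ x = 0} q := by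
  have hcl : IsClosed {x | 0 ≤ x ∧ x ≤ e ∧ ψ x = 0} :=
    isClosed_Ici.inter (isClosed_Iic.inter (isClosed_singleton.preimage ψ.continuous))
  obtain ⟨q, hq, hq'⟩ := hE.exists_isLUB (D := {x | 0 ≤ x ∧ x ≤ e ∧ ψ x = 0})
    ⟨0, le_rfl, he, map_zero ψ⟩ (by
      rintro x ⟨hx0, hxe, hx⟩ y ⟨hy0, hye, hy⟩
      refine ⟨x ⊔ y, ⟨le_sup_of_le_left hx0, sup_le hxe hye, ?_⟩, le_sup_left, le_sup_right⟩
      have h1 : x ⊔ y ≤ x + y := sup_le (le_add_of_nonneg_right hy0) (le_add_of_nonneg_left hx0)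
      have h2 := hψ _ (sub_nonneg.2 h1)
      have h3 := hψ _ (le_sup_of_le_left (b := y) hx0)
      rw [map_sub, map_add] at h2
      linarith) ⟨e, fun x hx => hx.2.1⟩
  exact ⟨q, by simpa [hcl.closure_eq] using hq, hq'.1⟩

/-- The null parts `q ψ` of the weak unit decrease as `ψ` grows, so they are directed downwards and
their infimum is reached along a sequence of functionals. A weighted sum of that sequence has the
least null part, which must be zero. -/
theorem OrderContinuousNorm.exists_strictlyPositive [CompleteSpace E] (hE : OrderContinuousNorm E)
    {e : E} (he : IsWeakUnit e) :
    ∃ ψ : E →L[ℝ] ℝ, (∀ x, 0 ≤ x → 0 ≤ ψ x) ∧ ∀ x, 0 ≤ x → ψ x = 0 → x = 0 := by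
  let P : Set (E →L[ℝ] ℝ) := {ψ | ∀ x, 0 ≤ x → 0 ≤ ψ x}
  choose! q hq using fun (ψ : E →L[ℝ] ℝ) (hψ : ψ ∈ P) => hE.exists_isGreatest_null he.1 ψ hψ
  have hadd : ∀ ψ ∈ P, ∀ ψ' ∈ P, ψ + ψ' ∈ P := fun ψ h ψ' h' x hx =>
    add_nonneg (h x hx) (h' x hx)
  have hmono : ∀ ψ ∈ P, ∀ ψ' ∈ P, (∀ x, 0 ≤ x → ψ' x = 0 → ψ x = 0) → q ψ' ≤ q ψ := by
    intro ψ h ψ' h' hle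
    obtain ⟨h1, h2, h3⟩ := (hq ψ' h').1
    exact (hq ψ h).2 ⟨h1, h2, hle _ h1 h3⟩
  have hsum : ∀ ψ ∈ P, ∀ ψ' ∈ P, ∀ x, 0 ≤ x → (ψ + ψ') x = 0 → ψ x = 0 ∧ ψ' x = 0 := by
    intro ψ h ψ' h' x hx h0
    have h1 := h x hx
    have h2 := h' x hx
    rw [add_apply] at h0
    constructor <;> linarith
  obtain ⟨z, hz, hz'⟩ := hE.exists_isGLB (D := q '' P) ⟨_, 0, fun x _ => le_rfl, rfl⟩ (by
      rintro _ ⟨ψ, h, rfl⟩ _ ⟨ψ', h', rfl⟩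
      exact ⟨_, ⟨ψ + ψ', hadd _ h _ h', rfl⟩,
        hmono _ h _ (hadd _ h _ h') fun x hx h0 => (hsum _ h _ h' x hx h0).1,
        hmono _ h' _ (hadd _ h _ h') fun x hx h0 => (hsum _ h _ h' x hx h0).2⟩)
    ⟨0, by rintro _ ⟨ψ, h, rfl⟩; exact (hq ψ h).1.1⟩
  obtain ⟨s, hsP, hs⟩ := mem_closure_iff_seq_limit.1 hz
  choose φ hφ hφs using hsP
  -- The weights make the series of functionals converge absolutely and stay positive, so a zero of
  -- the sum on the cone is a zero of every `φ n`.
  let c : ℕ → ℝ := fun n => (1 / 2) ^ n / (‖φ n‖ + 1)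
  have hc : ∀ n, 0 < c n := fun n => by positivity
  have hsm : Summable fun n => c n • φ n := by
    refine Summable.of_norm_bounded summable_geometric_two fun n => ?_
    rw [norm_smul, Real.norm_of_nonneg (hc n).le, div_mul_eq_mul_div]
    refine div_le_of_le_mul₀ (by positivity) (by positivity) ?_
    gcongr
    linarith
  let ψ : E →L[ℝ] ℝ := ∑' n, c n • φ n
  have hψsum : ∀ x, HasSum (fun n => c n * φ n x) (ψ x) := fun x => by
    have := hsm.hasSum.mapL (ContinuousLinearMap.apply ℝ ℝ x)
    simpa using this
  have hψ : ψ ∈ P := fun x hx => (hψsum x).nonneg fun n => mul_nonneg (hc n).le (hφ n x hx)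
  have hψ0 : ∀ n x, 0 ≤ x → ψ x = 0 → φ n x = 0 := by
    intro n x hx h0
    have h1 := hψsum x
    rw [h0, hasSum_zero_iff_of_nonneg fun n => mul_nonneg (hc n).le (hφ n x hx)] at h1
    have := congrFun h1 n
    simpa [(hc n).ne'] using this
  have hψz : q ψ ≤ z := ge_of_tendsto' hs fun n => by
    rw [← hφs n]; exact hmono _ (hφ n) _ hψ (hψ0 n)
  -- Otherwise add a positive functional that norms `q ψ`: minimality says that the null part cannot
  -- shrink, yet the new functional is nonzero there.
  have hqψ : q ψ = 0 := by
    by_contra hne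
    obtain ⟨ψ', hψ', -, h1⟩ := exists_positive_functional_norming (hq ψ hψ).1.1 hne
    have hP := hadd ψ hψ ψ' hψ'
    have h2 : q ψ ≤ q (ψ + ψ') := hψz.trans (hz'.1 ⟨_, hP, rfl⟩)
    have h3 := hP _ (sub_nonneg.2 h2)
    have h4 := hP _ (hq ψ hψ).1.1
    rw [map_sub, (hq _ hP).1.2.2] at h3
    have h5 := (hsum ψ hψ ψ' hψ' _ (hq ψ hψ).1.1 (by linarith)).2
    rw [h1] at h5
    exact hne (norm_eq_zero.1 h5)
  refine ⟨ψ, hψ, fun x hx h0 => he.2 x ?_⟩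
  rw [abs_of_nonneg hx]
  have h1 : 0 ≤ x ⊓ e := le_inf hx he.1
  have h2 := hψ _ (sub_nonneg.2 (inf_le_left : x ⊓ e ≤ x))
  have h3 := hψ _ h1
  rw [map_sub] at h2
  have h4 : x ⊓ e ≤ q ψ := (hq ψ hψ).2 ⟨h1, inf_le_right, by linarith⟩
  rw [hqψ] at h4
  rw [le_antisymm h4 h1, norm_zero]

/-- A strictly positive functional of norm at most one, and a weak unit of norm at most two on
which it takes the value one. -/
theorem OrderContinuousNorm.exists_normalized [CompleteSpace E] [Nontrivial E]
    (hE : OrderContinuousNorm E) (he : ∃ e : E, IsWeakUnit e) :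
    ∃ (e : E) (φ : E →L[ℝ] ℝ), IsWeakUnit e ∧ ‖e‖ ≤ 2 ∧ φ e = 1 ∧ (∀ x, 0 ≤ x → 0 ≤ φ x) ∧
      (∀ x, 0 ≤ x → φ x = 0 → x = 0) ∧ ∀ x, |φ x| ≤ ‖x‖ := by
  obtain ⟨e, he⟩ := he
  have he0 : e ≠ 0 := by
    rintro rfl
    obtain ⟨x, hx⟩ := exists_ne (0 : E)
    exact hx (he.2 x (by rw [inf_eq_right.2 (abs_nonneg x), norm_zero]))
  obtain ⟨ψ, hψ, hψ0⟩ := hE.exists_strictlyPositive he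
  obtain ⟨χ, hχ, hχn, hχe⟩ := exists_positive_functional_norming he.1 he0
  have hN : 0 < ‖e‖ := norm_pos_iff.2 he0
  have hM : 0 < ‖ψ‖ + 1 := by positivity
  -- Here `ψ` contributes strict positivity and `χ` the estimate `φ e ≥ ‖e‖ / 2`. Rescaling `e` to
  -- `φ e = 1` therefore leaves norm at most `2`, the constant in `‖f‖_E ≤ 2‖f‖_∞`.
  let φ : E →L[ℝ] ℝ := (2⁻¹ : ℝ) • χ + (2⁻¹ * (‖ψ‖ + 1)⁻¹) • ψ
  have hφ : ∀ x, φ x = 2⁻¹ * χ x + 2⁻¹ * (‖ψ‖ + 1)⁻¹ * ψ x := fun x => by simp [φ]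
  have hk : 0 < 2⁻¹ * (‖ψ‖ + 1)⁻¹ := by positivity
  have hφe : 2⁻¹ * ‖e‖ ≤ φ e := by
    rw [hφ, hχe]
    linarith [mul_nonneg hk.le (hψ e he.1)]
  have hφe0 : 0 < φ e := lt_of_lt_of_le (by positivity) hφe
  refine ⟨(φ e)⁻¹ • e, φ, ⟨smul_nonneg (by positivity) he.1, fun x hx => ?_⟩, ?_, ?_, ?_, ?_, ?_⟩
  · refine he.2 x ?_
    have hi : 0 < (φ e)⁻¹ := by positivity
    have h1 : |x| ⊓ (φ e)⁻¹ • e = 0 := norm_eq_zero.1 hx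
    have h2 : |x| ⊓ e ≤ 0 := by
      have h3 : e = φ e • (φ e)⁻¹ • e := by rw [smul_smul, mul_inv_cancel₀ hφe0.ne', one_smul]
      have hmax : 0 < max 1 (φ e) := by positivity
      calc |x| ⊓ e ≤ max 1 (φ e) • |x| ⊓ max 1 (φ e) • (φ e)⁻¹ • e := by
            refine inf_le_inf ?_ ?_
            · conv_lhs => rw [← one_smul ℝ |x|]
              exact smul_le_smul_of_nonneg_right (le_max_left _ _) (abs_nonneg x)
            · conv_lhs => rw [h3]
              exact smul_le_smul_of_nonneg_right (le_max_right _ _) (smul_nonneg hi.le he.1)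
        _ = max 1 (φ e) • (|x| ⊓ (φ e)⁻¹ • e) :=
            ((OrderIso.smulRight (β := E) hmax).map_inf _ _).symm
        _ = 0 := by rw [h1, smul_zero]
    rw [le_antisymm h2 (le_inf (abs_nonneg x) he.1), norm_zero]
  · rw [norm_smul, Real.norm_of_nonneg (by positivity), inv_mul_le_iff₀ hφe0]
    linarith
  · rw [map_smul, smul_eq_mul, inv_mul_cancel₀ hφe0.ne']
  · intro x hx
    rw [hφ]
    have := hψ x hx
    have := hχ x hx
    positivity
  · intro x hx h0
    rw [hφ] at h0
    have h1 := mul_nonneg hk.le (hψ x hx)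
    have h2 := hχ x hx
    have h3 : 2⁻¹ * (‖ψ‖ + 1)⁻¹ * ψ x = 0 := by linarith
    exact hψ0 x hx ((mul_eq_zero.1 h3).resolve_left hk.ne')
  · intro x
    rw [hφ]
    have h1 : |ψ x| ≤ (‖ψ‖ + 1) * ‖x‖ := by
      have := ψ.le_opNorm x
      rw [Real.norm_eq_abs] at this
      linarith [norm_nonneg x]
    have h2 : (‖ψ‖ + 1)⁻¹ * |ψ x| ≤ ‖x‖ := by
      rwa [inv_mul_le_iff₀ hM]
    calc _ ≤ |2⁻¹ * χ x| + |2⁻¹ * (‖ψ‖ + 1)⁻¹ * ψ x| := abs_add_le _ _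
      _ = 2⁻¹ * |χ x| + 2⁻¹ * ((‖ψ‖ + 1)⁻¹ * |ψ x|) := by
        rw [abs_mul, abs_mul, abs_of_pos hk, abs_of_pos (by norm_num : (0 : ℝ) < 2⁻¹), mul_assoc]
      _ ≤ ‖x‖ := by linarith [hχn x]

end PositiveFunctionals

/-! ### Kakutani representation of a vector lattice with order unit -/

section Kakutani

variable {V : Type u} [AddCommGroup V] [Lattice V] [IsOrderedAddMonoid V]

theorem add_inf_le_inf_add_inf {a b c : V} (ha : 0 ≤ a) (hb : 0 ≤ b) (hc : 0 ≤ c) :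
    (a + b) ⊓ c ≤ a ⊓ c + b ⊓ c := by
  rw [inf_add, add_inf, add_inf]
  exact le_inf (le_inf inf_le_left (inf_le_right.trans (le_add_of_nonneg_left ha)))
    (le_inf (inf_le_right.trans (le_add_of_nonneg_right hb))
      (inf_le_right.trans (le_add_of_nonneg_right hc)))

theorem inf_nsmul_eq_zero {a b : V} (ha : 0 ≤ a) (hb : 0 ≤ b) (hab : a ⊓ b = 0) (n : ℕ) :
    a ⊓ n • b = 0 := by
  induction n with
  | zero => simpa using ha
  | succ n ih =>
    refine le_antisymm ?_ (le_inf ha (nsmul_nonneg hb _))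
    rw [succ_nsmul, inf_comm]
    refine (add_inf_le_inf_add_inf (nsmul_nonneg hb n) hb ha).trans ?_
    rw [inf_comm, ih, inf_comm, hab, add_zero]

variable [Module ℝ V] [IsOrderedModule ℝ V]

/-- An additive, positively homogeneous function on the positive cone of a vector lattice extends
to a linear functional. -/
theorem exists_linearMap_of_cone (f : V → ℝ)
    (hadd : ∀ x y, 0 ≤ x → 0 ≤ y → f (x + y) = f x + f y)
    (hsmul : ∀ (c : ℝ) x, 0 < c → 0 ≤ x → f (c • x) = c * f x) :
    ∃ g : V →ₗ[ℝ] ℝ, ∀ x, 0 ≤ x → g x = f x := by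
  have h0 : f 0 = 0 := by simpa using hadd 0 0 le_rfl le_rfl
  have hp : ∀ x : V, 0 ≤ x⁺ := posPart_nonneg
  have hn : ∀ x : V, 0 ≤ x⁻ := negPart_nonneg
  have hpos : ∀ (c : ℝ) (x : V), 0 < c →
      f (c • x)⁺ - f (c • x)⁻ = c * (f x⁺ - f x⁻) := by
    intro c x hc
    have : (c • x)⁻ = c • x⁻ := by
      rw [← posPart_neg, ← smul_neg, smul_posPart_of_pos hc, posPart_neg]
    rw [this, smul_posPart_of_pos hc, hsmul c _ hc (hp x), hsmul c _ hc (hn x)]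
    ring
  refine ⟨{ toFun := fun x => f x⁺ - f x⁻, map_add' := ?_, map_smul' := ?_ }, ?_⟩
  · intro x y
    have e : (x + y)⁺ + (x⁻ + y⁻) = (x + y)⁻ + (x⁺ + y⁺) := by
      have h1 := posPart_sub_negPart (x + y)
      have h2 := posPart_sub_negPart x
      have h3 := posPart_sub_negPart y
      have : (x + y)⁺ - (x + y)⁻ = (x⁺ - x⁻) + (y⁺ - y⁻) := by rw [h1, h2, h3]
      rw [← sub_eq_zero] at this ⊢
      rw [← this]; abel
    have := congrArg f e
    rw [hadd _ _ (hp _) (add_nonneg (hn x) (hn y)), hadd _ _ (hn _) (add_nonneg (hp x) (hp y)),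
      hadd _ _ (hn x) (hn y), hadd _ _ (hp x) (hp y)] at this
    linarith
  · intro c x
    simp only [RingHom.id_apply, smul_eq_mul]
    rcases lt_trichotomy c 0 with hc | rfl | hc
    · have := hpos (-c) (-x) (by linarith)
      rw [smul_neg, neg_smul, neg_neg, posPart_neg, negPart_neg] at this
      linarith
    · simp
    · exact hpos c x hc
  · intro x hx
    simp [posPart_eq_self.2 hx, negPart_eq_zero.2 hx, h0]

/-- The functional `lim ψ (y ⊓ n u)`, the restriction of `ψ` to the band generated by `u`. -/
theorem exists_band_restriction (ψ : V →ₗ[ℝ] ℝ) (hψ : ∀ x, 0 ≤ x → 0 ≤ ψ x) {u : V} (hu : 0 ≤ u) :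
    ∃ θ : V →ₗ[ℝ] ℝ, (∀ y, 0 ≤ y → 0 ≤ θ y ∧ θ y ≤ ψ y) ∧ θ u = ψ u ∧
      ∀ y, 0 ≤ y → y ⊓ u = 0 → θ y = 0 := by
  have hmono : ∀ x y, x ≤ y → ψ x ≤ ψ y := fun x y h => by
    have := hψ _ (sub_nonneg.2 h); rw [map_sub] at this; linarith
  let f : V → ℝ := fun y => ⨆ n : ℕ, ψ (y ⊓ n • u)
  have hb : ∀ y, BddAbove (Set.range fun n : ℕ => ψ (y ⊓ n • u)) := fun y =>
    ⟨ψ y, by rintro _ ⟨n, rfl⟩; exact hmono _ _ inf_le_left⟩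
  have hm : ∀ y, Monotone fun n : ℕ => ψ (y ⊓ n • u) := fun y n m h =>
    hmono _ _ (inf_le_inf_left _ (nsmul_le_nsmul_left hu h))
  have ht : ∀ y, Tendsto (fun n : ℕ => ψ (y ⊓ n • u)) atTop (𝓝 (f y)) := fun y =>
    tendsto_atTop_ciSup (hm y) (hb y)
  have hle : ∀ y (n : ℕ), ψ (y ⊓ n • u) ≤ f y := fun y n => le_ciSup (hb y) n
  have hfle : ∀ y, f y ≤ ψ y := fun y => ciSup_le fun n => hmono _ _ inf_le_left
  have hhalf : ∀ (c : ℝ) x, 0 < c → 0 ≤ x → f (c • x) ≤ c * f x := by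
    intro c x hc hx
    refine ciSup_le fun n => ?_
    -- Only one inequality is needed for homogeneity; the reverse one is this one applied to `c⁻¹`.
    obtain ⟨m, hm⟩ := exists_nat_ge (c⁻¹ * n)
    calc ψ (c • x ⊓ n • u) ≤ ψ (c • (x ⊓ m • u)) := by
          refine hmono _ _ ?_
          rw [show c • (x ⊓ m • u) = c • x ⊓ c • m • u from
            (OrderIso.smulRight (β := V) hc).map_inf _ _]
          refine inf_le_inf_left _ ?_
          rw [← Nat.cast_smul_eq_nsmul ℝ n, ← Nat.cast_smul_eq_nsmul ℝ m, smul_smul]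
          exact smul_le_smul_of_nonneg_right ((inv_mul_le_iff₀ hc).1 hm) hu
      _ = c * ψ (x ⊓ m • u) := by rw [map_smul, smul_eq_mul]
      _ ≤ c * f x := by gcongr; exact hle x m
  obtain ⟨g, hg⟩ := exists_linearMap_of_cone f
    (fun x y hx hy => by
      apply le_antisymm
      · refine le_of_tendsto_of_tendsto' (ht _) ((ht x).add (ht y)) fun n => ?_
        rw [← map_add]
        exact hmono _ _ (add_inf_le_inf_add_inf hx hy (nsmul_nonneg hu n))
      · refine le_of_tendsto' ((ht x).add (ht y)) fun n => ?_
        rw [← map_add]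
        refine (hmono _ _ (le_inf (add_le_add inf_le_left inf_le_left) ?_)).trans (hle _ (n + n))
        rw [add_nsmul]
        exact add_le_add inf_le_right inf_le_right)
    (fun c x hc hx => by
      refine le_antisymm (hhalf c x hc hx) ?_
      have := hhalf c⁻¹ (c • x) (inv_pos.2 hc) (smul_nonneg hc.le hx)
      rwa [smul_smul, inv_mul_cancel₀ hc.ne', one_smul, ← div_eq_inv_mul, le_div_iff₀ hc,
        mul_comm] at this)
  refine ⟨g, fun y hy => ?_, ?_, fun y hy hyu => ?_⟩
  · rw [hg y hy]
    refine ⟨?_, hfle y⟩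
    have := hle y 0
    rw [zero_nsmul, inf_eq_right.2 hy, map_zero] at this
    exact this
  · rw [hg u hu]
    refine le_antisymm (hfle u) ?_
    have := hle u 1
    rwa [one_nsmul, inf_idem] at this
  · rw [hg y hy]
    simp [f, inf_nsmul_eq_zero hy hu hyu]

/-- The positive linear functionals taking the value one at `e`, as a subset of `V → ℝ`. -/
def stateSet (e : V) : Set (V → ℝ) :=
  {f | ∃ ψ : V →ₗ[ℝ] ℝ, (∀ x, 0 ≤ x → 0 ≤ ψ x) ∧ ψ e = 1 ∧ f = ψ}

theorem convex_stateSet (e : V) : Convex ℝ (stateSet e) := by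
  rintro _ ⟨ψ, hψ, hψe, rfl⟩ _ ⟨χ, hχ, hχe, rfl⟩ a b ha hb hab
  refine ⟨a • ψ + b • χ, fun x hx => ?_, ?_, rfl⟩
  · have := hψ x hx
    have := hχ x hx
    simp only [LinearMap.add_apply, LinearMap.smul_apply, smul_eq_mul]
    positivity
  · simp [hψe, hχe, hab]

theorem isClosed_stateSet (e : V) : IsClosed (stateSet e) := by
  have : stateSet e = {f | ∀ x y, f (x + y) = f x + f y} ∩ {f | ∀ (c : ℝ) x, f (c • x) = c * f x} ∩
      {f | ∀ x, 0 ≤ x → 0 ≤ f x} ∩ {f | f e = 1} := by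
    ext f
    constructor
    · rintro ⟨ψ, hψ, hψe, rfl⟩
      exact ⟨⟨⟨fun x y => map_add ψ x y, fun c x => map_smul ψ c x⟩, hψ⟩, hψe⟩
    · rintro ⟨⟨⟨h1, h2⟩, h3⟩, h4⟩
      exact ⟨{ toFun := f, map_add' := h1, map_smul' := h2 }, h3, h4, rfl⟩
  rw [this]
  refine ((IsClosed.inter ?_ ?_).inter ?_).inter ?_
  · simp only [Set.ofPred_forall]
    exact isClosed_iInter fun x => isClosed_iInter fun y => isClosed_eq (by fun_prop) (by fun_prop)
  · simp only [Set.ofPred_forall]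
    exact isClosed_iInter fun c => isClosed_iInter fun x => isClosed_eq (by fun_prop) (by fun_prop)
  · simp only [Set.ofPred_forall]
    exact isClosed_iInter fun x => isClosed_iInter fun _ => isClosed_le (by fun_prop) (by fun_prop)
  · exact isClosed_eq (by fun_prop) (by fun_prop)

/-- Tychonoff: the order unit confines each coordinate of a state to a fixed interval. -/
theorem isCompact_stateSet {e : V} (hunit : ∀ x : V, ∃ c : ℝ, 0 ≤ c ∧ |x| ≤ c • e) :
    IsCompact (stateSet e) := by
  choose c _ hc using hunit
  refine (isCompact_univ_pi fun x => isCompact_Icc (a := -c x) (b := c x)).of_isClosed_subset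
    (isClosed_stateSet e) ?_
  rintro _ ⟨ψ, hψ, hψe, rfl⟩ x -
  have h1 := hψ _ (sub_nonneg.2 ((le_abs_self x).trans (hc x)))
  have h2 := hψ _ (sub_nonneg.2 ((neg_le_abs x).trans (hc x)))
  simp only [map_sub, map_smul, map_neg, hψe, smul_eq_mul, mul_one] at h1 h2
  constructor <;> linarith

/-- The compact space of normalized real lattice homomorphisms. -/
def latticeCharSet (e : V) : Set (V → ℝ) :=
  {f | f ∈ stateSet e ∧ ∀ x, f |x| = |f x|}

theorem isCompact_latticeCharSet {e : V} (hunit : ∀ x : V, ∃ c : ℝ, 0 ≤ c ∧ |x| ≤ c • e) :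
    IsCompact (latticeCharSet e) := by
  refine (isCompact_stateSet hunit).inter_right (t := {f | ∀ x, f |x| = |f x|}) ?_
  simp only [Set.ofPred_forall]
  exact isClosed_iInter fun x => isClosed_eq (by fun_prop) (by fun_prop)

/-- Restricting a state `ψ` to the band of `x⁺` splits it into two positive functionals. Extremality
makes the pieces proportional to `ψ`, so `ψ` kills `x⁺` or `x⁻`. -/
theorem extremePoints_stateSet_subset {e : V} (he : 0 ≤ e)
    (hunit : ∀ x : V, ∃ c : ℝ, 0 ≤ c ∧ |x| ≤ c • e) :
    (stateSet e).extremePoints ℝ ⊆ latticeCharSet e := by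
  intro f hf
  rw [mem_extremePoints] at hf
  obtain ⟨⟨ψ, hψ, hψe, rfl⟩, hext⟩ := hf
  refine ⟨⟨ψ, hψ, hψe, rfl⟩, fun x => ?_⟩
  have hzero : ∀ χ : V →ₗ[ℝ] ℝ, (∀ x, 0 ≤ x → 0 ≤ χ x) → χ e = 0 → ∀ x, 0 ≤ x → χ x = 0 := by
    intro χ hχ hχe x hx
    obtain ⟨c, _, hc⟩ := hunit x
    have h1 := hχ _ (sub_nonneg.2 ((le_abs_self x).trans hc))
    rw [map_sub, map_smul, hχe, smul_zero] at h1
    linarith [hχ x hx]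
  have key : ψ x⁺ = 0 ∨ ψ x⁻ = 0 := by
    obtain ⟨θ, hθ, hθu, hθ0⟩ := exists_band_restriction ψ hψ (posPart_nonneg x)
    have hx : θ x⁻ = 0 := hθ0 _ (negPart_nonneg x) (by
      rw [inf_comm]; exact posPart_inf_negPart_eq_zero x)
    have hd : ∀ y, 0 ≤ y → 0 ≤ (ψ - θ) y := fun y hy => by
      simpa using (hθ y hy).2
    obtain ⟨h0, h1⟩ := hθ e he
    rw [hψe] at h1
    -- When `θ e` is `0` or `1` one piece vanishes identically; otherwise the normalized pieces are
    -- states and `ψ` is a proper convex combination of them.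
    rcases h0.eq_or_lt with h0 | h0
    · left
      rw [← hθu]
      exact hzero θ (fun y hy => (hθ y hy).1) h0.symm _ (posPart_nonneg x)
    rcases h1.eq_or_lt with h1 | h1
    · right
      have := hzero (ψ - θ) hd (by simp [hψe, h1]) x⁻ (negPart_nonneg x)
      simpa [hx] using this
    · right
      have h1' : 0 < 1 - θ e := by linarith
      have := (hext ((θ e)⁻¹ • θ : V →ₗ[ℝ] ℝ)
        ⟨_, fun y hy => by
          have := (hθ y hy).1
          simp only [LinearMap.smul_apply, smul_eq_mul]; positivity,
          by simp [h0.ne'], rfl⟩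
        ((1 - θ e)⁻¹ • (ψ - θ) : V →ₗ[ℝ] ℝ)
        ⟨_, fun y hy => by
          have := hd y hy
          simp only [LinearMap.smul_apply, smul_eq_mul]; positivity,
          by simp [hψe, h1'.ne'], rfl⟩
        ⟨θ e, 1 - θ e, h0, h1', by ring, by
          ext y
          simp [h0.ne', h1'.ne']⟩).1
      have h2 := congrFun this x⁻
      simpa [hx] using h2.symm
  have hxx : ψ x = ψ x⁺ - ψ x⁻ := by rw [← map_sub, posPart_sub_negPart]
  rw [← posPart_add_negPart x, map_add, hxx]
  have h1 := hψ _ (posPart_nonneg x)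
  have h2 := hψ _ (negPart_nonneg x)
  rcases key with h | h
  · rw [h, zero_add, zero_sub, abs_neg, abs_of_nonneg h2]
  · rw [h, add_zero, sub_zero, abs_of_nonneg h1]

/-- Krein-Milman: the inequality holds at extreme states, and it defines a closed convex set. -/
theorem le_of_forall_latticeChar_le {e : V} (he : 0 ≤ e)
    (hunit : ∀ x : V, ∃ c : ℝ, 0 ≤ c ∧ |x| ≤ c • e) {f : V → ℝ} (hf : f ∈ stateSet e) {x : V} {a : ℝ}
    (h : ∀ g ∈ latticeCharSet e, g x ≤ a) : f x ≤ a := by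
  have hcl : closure (convexHull ℝ ((stateSet e).extremePoints ℝ)) ⊆ {g | g x ≤ a} := by
    refine closure_minimal (convexHull_min (fun g hg => h g
      (extremePoints_stateSet_subset he hunit hg)) ?_)
      (isClosed_le (by fun_prop) (by fun_prop))
    exact convex_halfSpace_le (LinearMap.proj (R := ℝ) (φ := fun _ : V => ℝ) x).isLinear a
  rw [closure_convexHull_extremePoints (isCompact_stateSet hunit) (convex_stateSet e)] at hcl
  exact hcl hf

/-- Evaluation of the elements of `V` as continuous functions on the space of lattice
homomorphisms. -/
def latticeEval (e : V) : V →ₗ[ℝ] C(latticeCharSet e, ℝ) where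
  toFun x := ⟨fun k => k.1 x, (continuous_apply x).comp continuous_subtype_val⟩
  map_add' x y := by
    ext ⟨k, ⟨ψ, _, _, rfl⟩, _⟩
    exact map_add ψ x y
  map_smul' c x := by
    ext ⟨k, ⟨ψ, _, _, rfl⟩, _⟩
    exact map_smul ψ c x

theorem latticeEval_apply (e x : V) (k : latticeCharSet e) : latticeEval e x k = k.1 x := rfl

theorem latticeEval_unit (e : V) : latticeEval e e = 1 := by
  ext ⟨k, ⟨ψ, _, h, rfl⟩, _⟩
  exact h

theorem latticeEval_abs (e x : V) : latticeEval e |x| = |latticeEval e x| := by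
  ext k
  rw [ContinuousMap.abs_apply]
  exact k.2.2 x

theorem map_sup_of_map_abs {W : Type*} [AddCommGroup W] [Lattice W] [IsOrderedAddMonoid W]
    [Module ℝ W] (J : V →ₗ[ℝ] W) (hJ : ∀ x, J |x| = |J x|) (x y : V) :
    J (x ⊔ y) = J x ⊔ J y := by
  rw [sup_eq_half_smul_add_add_abs_sub ℝ, sup_eq_half_smul_add_add_abs_sub ℝ, map_smul, map_add,
    map_add, hJ, map_sub]

theorem map_inf_of_map_abs {W : Type*} [AddCommGroup W] [Lattice W] [IsOrderedAddMonoid W]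
    [Module ℝ W] (J : V →ₗ[ℝ] W) (hJ : ∀ x, J |x| = |J x|) (x y : V) :
    J (x ⊓ y) = J x ⊓ J y := by
  have := map_sup_of_map_abs J hJ (-x) (-y)
  rw [← neg_inf, map_neg, map_neg, map_neg, ← neg_inf] at this
  exact neg_injective this

/-- Lattice form of Stone-Weierstrass; values at two distinct points are interpolated by a
combination of a separating `x` and the unit. -/
theorem denseRange_latticeEval {e : V} (hunit : ∀ x : V, ∃ c : ℝ, 0 ≤ c ∧ |x| ≤ c • e) :
    DenseRange (latticeEval e) := by
  have : CompactSpace (latticeCharSet e) :=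
    isCompact_iff_compactSpace.1 (isCompact_latticeCharSet hunit)
  rw [DenseRange, dense_iff_closure_eq]
  refine ContinuousMap.sublattice_closure_eq_top _ ⟨_, 0, rfl⟩ ?_ ?_ ?_
  · rintro _ ⟨x, rfl⟩ _ ⟨y, rfl⟩
    exact ⟨x ⊓ y, map_inf_of_map_abs _ (latticeEval_abs e) x y⟩
  · rintro _ ⟨x, rfl⟩ _ ⟨y, rfl⟩
    exact ⟨x ⊔ y, map_sup_of_map_abs _ (latticeEval_abs e) x y⟩
  · intro v h k
    by_cases hk : h = k
    · subst hk
      refine ⟨_, ⟨v h • e, rfl⟩, ?_⟩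
      simp [latticeEval_unit]
    · obtain ⟨x, hx⟩ := Function.ne_iff.1 (fun h' => hk (Subtype.ext h'))
      have hx' : h.1 x - k.1 x ≠ 0 := sub_ne_zero.2 hx
      refine ⟨_, ⟨((v h - v k) / (h.1 x - k.1 x)) • x +
        (v h - (v h - v k) / (h.1 x - k.1 x) * h.1 x) • e, rfl⟩, ?_, ?_⟩
      · simp [latticeEval_unit, latticeEval_apply]
      · simp only [map_add, map_smul, latticeEval_unit, ContinuousMap.add_apply,
          ContinuousMap.smul_apply, latticeEval_apply, ContinuousMap.one_apply, smul_eq_mul]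
        field_simp
        ring

/-- Since `φ x` is at most the supremum of the evaluation of `x`, `φ` factors through the range of
`latticeEval`. Hahn-Banach with the supremum as sublinear bound extends it, and this bound forces
positivity. -/
theorem exists_positive_extension {e : V} (he : 0 ≤ e)
    (hunit : ∀ x : V, ∃ c : ℝ, 0 ≤ c ∧ |x| ≤ c • e)
    {φ : V →ₗ[ℝ] ℝ} (hφ : ∀ x, 0 ≤ x → 0 ≤ φ x) (hφe : φ e = 1) :
    ∃ Λ : C(latticeCharSet e, ℝ) →ₗ[ℝ] ℝ, (∀ g, 0 ≤ g → 0 ≤ Λ g) ∧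
      ∀ x, Λ (latticeEval e x) = φ x := by
  have : CompactSpace (latticeCharSet e) :=
    isCompact_iff_compactSpace.1 (isCompact_latticeCharSet hunit)
  have hS : (φ : V → ℝ) ∈ stateSet e := ⟨φ, hφ, hφe, rfl⟩
  -- On an empty space the bound by `0` would hold vacuously, against `φ e = 1`.
  have hne : Nonempty (latticeCharSet e) := by
    by_contra hcon
    rw [not_nonempty_iff] at hcon
    have := le_of_forall_latticeChar_le he hunit hS (x := e) (a := 0) fun g hg =>
      (hcon.false ⟨g, hg⟩).elim
    rw [hφe] at this
    linarith
  set J := latticeEval e with hJ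
  have hbdd : ∀ g : C(latticeCharSet e, ℝ), BddAbove (Set.range g) := fun g =>
    ⟨‖g‖, by rintro _ ⟨k, rfl⟩; exact (le_abs_self _).trans (g.norm_coe_le_norm k)⟩
  have hle : ∀ x, φ x ≤ ⨆ k, J x k := fun x =>
    le_of_forall_latticeChar_le he hunit hS fun g hg =>
      le_ciSup (hbdd (J x)) (⟨g, hg⟩ : latticeCharSet e)
  have hker : LinearMap.ker J ≤ LinearMap.ker φ := by
    intro x hx
    rw [LinearMap.mem_ker] at hx ⊢
    have h1 := hle x
    have h2 := hle (-x)
    rw [map_neg, map_neg, hx] at h2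
    rw [hx] at h1
    simp at h1 h2
    linarith
  let F : C(latticeCharSet e, ℝ) →ₗ.[ℝ] ℝ :=
    { domain := LinearMap.range J
      toFun := (LinearMap.ker J).liftQ φ hker ∘ₗ J.quotKerEquivRange.symm.toLinearMap }
  have hF : ∀ x (hx : J x ∈ F.domain), F ⟨J x, hx⟩ = φ x := by
    intro x hx
    change (LinearMap.ker J).liftQ φ hker (J.quotKerEquivRange.symm ⟨J x, hx⟩) = φ x
    rw [LinearMap.quotKerEquivRange_symm_apply_image]
    simp
  obtain ⟨Λ, hΛ, hΛ'⟩ := exists_extension_of_le_sublinear F (fun g => ⨆ k, g k)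
    (fun c hc g => by
      simp only [ContinuousMap.smul_apply, smul_eq_mul]
      rw [Real.mul_iSup_of_nonneg hc.le])
    (fun g h => ciSup_le fun k => add_le_add (le_ciSup (hbdd g) k) (le_ciSup (hbdd h) k))
    (by
      rintro ⟨_, x, rfl⟩
      exact (hF x ⟨x, rfl⟩).trans_le (hle x))
  refine ⟨Λ, fun g hg => ?_, fun x => ?_⟩
  · have h1 : Λ (-g) ≤ 0 := (hΛ' (-g)).trans (ciSup_le fun k => by
      simpa using hg k)
    rw [map_neg] at h1
    linarith
  · rw [← hF x ⟨x, rfl⟩]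
    exact hΛ ⟨J x, ⟨x, rfl⟩⟩

/-- A positive functional on a vector lattice with order unit is represented by a regular Borel
measure on a compact space. -/
theorem exists_measure_representing {e : V} (he : 0 ≤ e)
    (hunit : ∀ x : V, ∃ c : ℝ, 0 ≤ c ∧ |x| ≤ c • e)
    {φ : V →ₗ[ℝ] ℝ} (hφ : ∀ x, 0 ≤ x → 0 ≤ φ x) (hφe : φ e = 1) :
    letI : MeasurableSpace (latticeCharSet e) := borel _
    ∃ μ : Measure (latticeCharSet e), IsProbabilityMeasure μ ∧ μ.Regular ∧
      ∀ x, ∫ k, latticeEval e x k ∂μ = φ x := by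
  let : MeasurableSpace (latticeCharSet e) := borel _
  have : BorelSpace (latticeCharSet e) := ⟨rfl⟩
  have : CompactSpace (latticeCharSet e) :=
    isCompact_iff_compactSpace.1 (isCompact_latticeCharSet hunit)
  obtain ⟨Λ, hΛ, hΛφ⟩ := exists_positive_extension he hunit hφ hφe
  let Λ' : CompactlySupportedContinuousMap (latticeCharSet e) ℝ →ₚ[ℝ] ℝ :=
    PositiveLinearMap.mk₀
      { toFun := fun g => Λ g.toContinuousMap
        map_add' := fun f g => map_add Λ f.toContinuousMap g.toContinuousMap
        map_smul' := fun c g => map_smul Λ c g.toContinuousMap }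
      fun g hg => hΛ _ hg
  have hint : ∀ x, ∫ k, latticeEval e x k ∂(RealRMK.rieszMeasure Λ') = φ x := by
    intro x
    rw [← hΛφ]
    exact RealRMK.integral_rieszMeasure Λ'
      (CompactlySupportedContinuousMap.continuousMapEquiv (latticeEval e x))
  refine ⟨RealRMK.rieszMeasure Λ', ?_, inferInstance, hint⟩
  have h1 := hint e
  rw [latticeEval_unit, hφe] at h1
  simp only [ContinuousMap.one_apply, integral_const, smul_eq_mul, mul_one] at h1
  refine ⟨?_⟩
  have := (ENNReal.toReal_eq_one_iff _).1 h1
  exact this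

end Kakutani

/-! ### The vector lattice generated by a positive vector -/

section PrincipalIdeal

variable {E : Type u} [AddCommGroup E] [Module ℝ E] [Lattice E]
  [IsOrderedAddMonoid E] [IsOrderedModule ℝ E]

/-- The order ideal generated by a positive vector. -/
def principalIdeal (e : E) : Submodule ℝ E where
  carrier := {x | ∃ c : ℝ, 0 ≤ c ∧ |x| ≤ c • e}
  zero_mem' := ⟨0, le_rfl, by simp⟩
  add_mem' := by
    rintro x y ⟨c, hc, hx⟩ ⟨d, hd, hy⟩
    refine ⟨c + d, add_nonneg hc hd, (abs_add_le x y).trans ?_⟩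
    rw [add_smul]
    exact add_le_add hx hy
  smul_mem' := by
    have pos : ∀ (a : ℝ) (x : E), 0 ≤ a → (∃ c : ℝ, 0 ≤ c ∧ |x| ≤ c • e) →
        ∃ c : ℝ, 0 ≤ c ∧ |a • x| ≤ c • e := by
      rintro a x ha ⟨c, hc, hx⟩
      refine ⟨a * c, mul_nonneg ha hc, sup_le ?_ ?_⟩
      · rw [mul_smul]
        exact smul_le_smul_of_nonneg_left ((le_abs_self x).trans hx) ha
      · rw [mul_smul, ← smul_neg]
        exact smul_le_smul_of_nonneg_left ((neg_le_abs x).trans hx) ha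
    rintro a x hx
    rcases le_total 0 a with ha | ha
    · exact pos a x ha hx
    · have := pos (-a) x (neg_nonneg.2 ha) hx
      rwa [neg_smul, abs_neg] at this

theorem mem_principalIdeal_of_abs_le {e : E} {x y : E} (h : |x| ≤ |y|)
    (hy : y ∈ principalIdeal e) : x ∈ principalIdeal e := by
  obtain ⟨c, hc, hy⟩ := hy
  exact ⟨c, hc, h.trans hy⟩

theorem abs_mem_principalIdeal {e : E} {x : E} (hx : x ∈ principalIdeal e) :
    |x| ∈ principalIdeal e :=
  mem_principalIdeal_of_abs_le (by rw [abs_abs]) hx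

theorem sup_mem_principalIdeal {e : E} {x y : E} (hx : x ∈ principalIdeal e)
    (hy : y ∈ principalIdeal e) : x ⊔ y ∈ principalIdeal e := by
  rw [sup_eq_half_smul_add_add_abs_sub ℝ]
  exact Submodule.smul_mem _ _ (add_mem (add_mem hx hy)
    (abs_mem_principalIdeal (sub_mem hy hx)))

theorem inf_mem_principalIdeal {e : E} {x y : E} (hx : x ∈ principalIdeal e)
    (hy : y ∈ principalIdeal e) : x ⊓ y ∈ principalIdeal e := by
  have := neg_mem (sup_mem_principalIdeal (neg_mem hx) (neg_mem hy))
  rwa [← neg_inf, neg_neg] at this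

instance (e : E) : Lattice (principalIdeal e) :=
  Subtype.lattice (fun _ _ => sup_mem_principalIdeal) (fun _ _ => inf_mem_principalIdeal)

instance (e : E) : IsOrderedAddMonoid (principalIdeal e) where
  add_le_add_left _ _ h c := add_le_add_left (α := E) h c

instance (e : E) : IsOrderedModule ℝ (principalIdeal e) where
  smul_le_smul_of_nonneg_left _ ha _ _ h := smul_le_smul_of_nonneg_left (β := E) h ha
  smul_le_smul_of_nonneg_right _ hx _ _ h := smul_le_smul_of_nonneg_right (β := E) h hx

theorem coe_abs_principalIdeal {e : E} (x : principalIdeal e) :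
    ((|x| : principalIdeal e) : E) = |(x : E)| := rfl

end PrincipalIdeal

/-! ### Existence of a Köthe representation -/

section Representation

variable {E : Type u} [NormedAddCommGroup E] [NormedSpace ℝ E] [Lattice E]
  [IsOrderedAddMonoid E] [IsOrderedModule ℝ E] [HasSolidNorm E]

theorem OrderContinuousNorm.dense_principalIdeal [CompleteSpace E] (hE : OrderContinuousNorm E)
    {e : E} (he : IsWeakUnit e) : Dense (principalIdeal e : Set E) := by
  intro x
  have hpos : ∀ y : E, 0 ≤ y → y ∈ (principalIdeal e).topologicalClosure := by
    intro y hy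
    refine mem_closure_of_tendsto (hE.tendsto_inf_nsmul he hy) (Eventually.of_forall fun n => ?_)
    refine ⟨n, n.cast_nonneg, ?_⟩
    rw [abs_of_nonneg (le_inf hy (nsmul_nonneg he.1 n)), Nat.cast_smul_eq_nsmul]
    exact inf_le_right
  have := sub_mem (hpos _ (posPart_nonneg x)) (hpos _ (negPart_nonneg x))
  rw [posPart_sub_negPart] at this
  exact this

/-- The extension of a representation of the principal ideal to a lattice embedding into `L¹`. -/
theorem OrderContinuousNorm.exists_L1_embedding [CompleteSpace E] (hE : OrderContinuousNorm E)
    {e : E} (he : IsWeakUnit e) {φ : E →L[ℝ] ℝ} (hφ : ∀ x, 0 ≤ x → 0 ≤ φ x) (hφe : φ e = 1)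
    (hφn : ∀ x, |φ x| ≤ ‖x‖) :
    ∃ (Ω : Type u) (_ : MeasurableSpace Ω) (μ : Measure Ω) (_ : IsProbabilityMeasure μ)
      (J : E →L[ℝ] Lp ℝ 1 μ), (∀ x, J |x| = |J x|) ∧ (∀ x, ‖J x‖ = φ |x|) ∧
        (J e =ᵐ[μ] fun _ => 1) ∧ DenseRange J := by
  let V := principalIdeal e
  have heV : e ∈ V := ⟨1, zero_le_one, by rw [one_smul, abs_of_nonneg he.1]⟩
  let e' : V := ⟨e, heV⟩
  have he' : 0 ≤ e' := he.1
  have hunit : ∀ x : V, ∃ c : ℝ, 0 ≤ c ∧ |x| ≤ c • e' := fun x => x.2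
  let : MeasurableSpace (latticeCharSet e') := borel _
  have : BorelSpace (latticeCharSet e') := ⟨rfl⟩
  have : CompactSpace (latticeCharSet e') :=
    isCompact_iff_compactSpace.1 (isCompact_latticeCharSet hunit)
  obtain ⟨μ, hμ, hreg, hint⟩ := exists_measure_representing he' hunit
    (φ := φ.toLinearMap ∘ₗ V.subtype) (fun x hx => hφ _ hx) hφe
  let f : V →ₗ[ℝ] Lp ℝ 1 μ :=
    (ContinuousMap.toLp 1 μ ℝ : C(latticeCharSet e', ℝ) →L[ℝ] Lp ℝ 1 μ).toLinearMap ∘ₗ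
      latticeEval e'
  have hcoe : ∀ x, f x =ᵐ[μ] latticeEval e' x := fun x => ContinuousMap.coeFn_toLp μ _
  have hnorm : ∀ x : V, ‖f x‖ = φ |(x : E)| := by
    intro x
    have h1 : φ |(x : E)| = ∫ k, latticeEval e' |x| k ∂μ := (hint |x|).symm
    rw [h1, L1.norm_eq_integral_norm, latticeEval_abs]
    refine integral_congr_ae ?_
    filter_upwards [hcoe x] with k hk
    rw [hk, ContinuousMap.abs_apply, Real.norm_eq_abs]
  have habs : ∀ x : V, f |x| = |f x| := by
    intro x
    refine Lp.ext ?_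
    filter_upwards [hcoe x, hcoe |x|, Lp.coeFn_abs (f x)] with k h1 h2 h3
    rw [h2, h3, h1, latticeEval_abs, ContinuousMap.abs_apply]
  have hdense : DenseRange V.subtype := by
    simpa [DenseRange] using hE.dense_principalIdeal he
  have hbound : ∃ C, ∀ x : V, ‖f x‖ ≤ C * ‖V.subtype x‖ := ⟨1, fun x => by
    rw [hnorm, one_mul, ← norm_abs_eq_norm]
    exact (le_abs_self _).trans (hφn _)⟩
  let J := f.extendOfNorm V.subtype
  have hJ : ∀ x : V, J x = f x := fun x => LinearMap.extendOfNorm_eq hdense hbound x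
  have hcabs : Continuous fun x : E => |x| := by
    change Continuous fun x : E => x ⊔ -x
    fun_prop
  have hcabs' : Continuous fun x : Lp ℝ 1 μ => |x| := by
    change Continuous fun x : Lp ℝ 1 μ => x ⊔ -x
    fun_prop
  refine ⟨latticeCharSet e', inferInstance, μ, hμ, J, fun x => ?_, fun x => ?_, ?_, ?_⟩
  · refine hdense.induction_on (p := fun x => J |x| = |J x|) x
      (isClosed_eq (J.continuous.comp hcabs) (hcabs'.comp J.continuous)) fun y => ?_
    rw [Submodule.subtype_apply, hJ, ← habs, ← hJ, coe_abs_principalIdeal]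
  · refine hdense.induction_on (p := fun x => ‖J x‖ = φ |x|) x
      (isClosed_eq J.continuous.norm (φ.continuous.comp hcabs)) fun y => ?_
    rw [Submodule.subtype_apply, hJ, hnorm]
  · rw [show J e = f e' from hJ e']
    filter_upwards [hcoe e'] with k hk
    rw [hk, latticeEval_unit]
    rfl
  · have h1 : DenseRange f :=
      (ContinuousMap.toLp_denseRange ℝ μ ℝ ENNReal.one_ne_top).comp
        (denseRange_latticeEval hunit) (ContinuousMap.toLp 1 μ ℝ).continuous
    refine h1.mono ?_
    rintro _ ⟨x, rfl⟩
    exact ⟨x, hJ x⟩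

/-- Order bounded sequences which are rapidly Cauchy for the seminorm `φ |x|` have a limit for this
seminorm. -/
theorem OrderContinuousNorm.exists_limit_of_bounded [CompleteSpace E] (hE : OrderContinuousNorm E)
    {F : Type*} [NormedAddCommGroup F] [NormedSpace ℝ F]
    {φ : E →L[ℝ] ℝ} (hφ : ∀ x, 0 ≤ x → 0 ≤ φ x) (J : E →L[ℝ] F) (hJ : ∀ x, ‖J x‖ = φ |x|)
    {a b : E} {x : ℕ → E} (ha : ∀ n, a ≤ x n) (hb : ∀ n, x n ≤ b) {C : ℝ}
    (hx : ∀ n, ‖J (x (n + 1) - x n)‖ ≤ C * (1 / 2) ^ n) {f : F}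
    (hf : Tendsto (fun n => J (x n)) atTop (𝓝 f)) : ∃ y, J y = f := by
  have hmono : ∀ x y, x ≤ y → φ x ≤ φ y := fun x y h => by
    have := hφ _ (sub_nonneg.2 h); rw [map_sub] at this; linarith
  -- The limit is a limit superior: `w n k` is the supremum of `x n, …, x (n + k)`, the limit of `w
  -- n` is the tail supremum `y n`, and `y` decreases.
  let w : ℕ → ℕ → E := fun n => partialSups fun j => x (n + j)
  have hw : ∀ n, Monotone (w n) := fun n => (partialSups _).monotone
  have hwb : ∀ n k, w n k ≤ b := fun n k => partialSups_le _ _ _ fun j _ => hb _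
  choose y hy using fun n => hE.tendsto_of_monotone (hw n) (hwb n)
  have hwy : ∀ n k, w n k ≤ y n := fun n k => (hw n).ge_of_tendsto (hy n) k
  have hw0 : ∀ n, w n 0 = x n := fun n => by simp [w]
  have hxy : ∀ n, x n ≤ y n := fun n => (hw0 n).symm.le.trans (hwy n 0)
  -- The right side is the finite geometric sum of the increments `C * (1 / 2) ^ (n + i)` for `i <
  -- k`.
  have hstep : ∀ n k, φ (w n k - x n) ≤ 2 * C * (1 / 2) ^ n * (1 - (1 / 2) ^ k) := by
    intro n k
    induction k with
    | zero => simp [hw0]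
    | succ k ih =>
      have e1 : w n (k + 1) = w n k ⊔ x (n + (k + 1)) := partialSups_add_one _ _
      have h1 : x (n + k) ≤ w n k := le_partialSups (fun j => x (n + j)) k
      have h2 : w n (k + 1) - x n ≤ (w n k - x n) + |x (n + k + 1) - x (n + k)| := by
        rw [e1, sub_le_iff_le_add]
        refine sup_le ?_ ?_
        · have := abs_nonneg (x (n + k + 1) - x (n + k))
          calc w n k = (w n k - x n) + 0 + x n := by abel
            _ ≤ _ := by gcongr
        · have := le_abs_self (x (n + k + 1) - x (n + k))
          calc x (n + (k + 1)) = (x (n + k) - x n) + (x (n + k + 1) - x (n + k)) + x n := by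
                rw [← add_assoc n k 1]; abel
            _ ≤ _ := by gcongr
      have h3 := hmono _ _ h2
      rw [map_add, ← hJ] at h3
      have h4 := hx (n + k)
      have h5 : 2 * C * (1 / 2) ^ n * (1 - (1 / 2) ^ (k + 1)) =
          2 * C * (1 / 2) ^ n * (1 - (1 / 2) ^ k) + C * (1 / 2 : ℝ) ^ (n + k) := by
        rw [pow_add, pow_succ]; ring
      linarith
  have hC : 0 ≤ C := by
    have := (norm_nonneg _).trans (hx 0)
    simpa using this
  have hyx : ∀ n, ‖J (y n) - J (x n)‖ ≤ 2 * C * (1 / 2) ^ n := by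
    intro n
    rw [← map_sub, hJ, abs_of_nonneg (sub_nonneg.2 (hxy n))]
    refine le_of_tendsto' ((φ.continuous.tendsto _).comp ((hy n).sub_const (x n))) fun k => ?_
    refine (hstep n k).trans ?_
    have h1 : (0 : ℝ) ≤ (1 / 2) ^ k := by positivity
    have h2 : 0 ≤ 2 * C * (1 / 2) ^ n := by positivity
    nlinarith
  have hanti : Antitone y := antitone_nat_of_succ_le fun n => by
    refine le_of_tendsto' (hy (n + 1)) fun k => ?_
    refine partialSups_le _ _ _ fun j hj => ?_
    refine le_trans ?_ (hwy n (j + 1))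
    rw [show n + 1 + j = n + (j + 1) by omega]
    exact le_partialSups (fun j => x (n + j)) (j + 1)
  obtain ⟨z, hz⟩ := hE.tendsto_of_antitone hanti (b := a) fun n => (ha n).trans (hxy n)
  refine ⟨z, tendsto_nhds_unique ((J.continuous.tendsto _).comp hz) ?_⟩
  have h0 : Tendsto (fun n => J (y n) - J (x n)) atTop (𝓝 0) := by
    refine squeeze_zero_norm hyx ?_
    have := (tendsto_pow_atTop_nhds_zero_of_lt_one (r := (1 / 2 : ℝ)) (by norm_num)
      (by norm_num)).const_mul (2 * C)
    simpa using this
  have := h0.add hf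
  simp only [sub_add_cancel, zero_add] at this
  exact this

/-- The image of `e` is the constant function `1`, so `L_∞` bounds become order bounds by multiples
of `e`. -/
theorem OrderContinuousNorm.exists_kotheRepresentation [CompleteSpace E] [Nontrivial E]
    (hE : OrderContinuousNorm E) (he : ∃ e : E, IsWeakUnit e) :
    ∃ (Ω : Type u) (_ : MeasurableSpace Ω) (μ : Measure Ω), Nonempty (KotheRepresentation E μ) := by
  obtain ⟨e, φ, he, hen, hφe, hφ, hφ0, hφn⟩ := hE.exists_normalized he
  obtain ⟨Ω, mΩ, μ, hμ, J, habs, hnorm, hJe, hdense⟩ := hE.exists_L1_embedding he hφ hφe hφn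
  refine ⟨Ω, mΩ, μ, ⟨?_⟩⟩
  have hsup := map_sup_of_map_abs J.toLinearMap habs
  have hinf := map_inf_of_map_abs J.toLinearMap habs
  simp only [ContinuousLinearMap.coe_coe] at hsup hinf
  have hle : ∀ x y : E, J x ≤ J y ↔ x ≤ y := by
    intro x y
    rw [← sup_eq_right, ← sup_eq_right (a := x), ← hsup]
    refine ⟨fun h => ?_, fun h => by rw [h]⟩
    have h1 : ‖J (x ⊔ y - y)‖ = 0 := by rw [map_sub, h, sub_self, norm_zero]
    rw [hnorm] at h1
    have := hφ0 _ (abs_nonneg _) h1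
    rw [abs_of_nonneg (sub_nonneg.2 le_sup_right)] at this
    exact sub_eq_zero.1 this
  have hsmul : ∀ c : ℝ, J (c • e) =ᵐ[μ] fun _ => c := by
    intro c
    rw [map_smul]
    filter_upwards [Lp.coeFn_smul c (J e), hJe] with t h1 h2
    rw [h1, Pi.smul_apply, h2, smul_eq_mul, mul_one]
  have hbd : ∀ (f : Lp ℝ 1 μ) (c : ℝ), (∀ᵐ t ∂μ, ‖f t‖ ≤ c) → J (-(c • e)) ≤ f ∧ f ≤ J (c • e) := by
    intro f c h
    rw [← neg_smul, ← Lp.coeFn_le, ← Lp.coeFn_le]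
    constructor
    · filter_upwards [hsmul (-c), h] with t h1 h2
      rw [h1]; exact (abs_le.1 h2).1
    · filter_upwards [hsmul c, h] with t h1 h2
      rw [h1]; exact (abs_le.1 h2).2
  have hess : ∀ f : Lp ℝ 1 μ, MemLp f ∞ μ → ∀ᵐ t ∂μ, ‖f t‖ ≤ (eLpNorm f ∞ μ).toReal := by
    intro f hf
    have hfin : eLpNorm f ∞ μ ≠ ∞ := hf.2.ne
    rw [eLpNorm_exponent_top] at hfin ⊢
    filter_upwards [ae_le_eLpNormEssSup (f := f) (μ := μ)] with t ht
    rw [← toReal_enorm]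
    exact ENNReal.toReal_mono hfin ht
  have hmem : ∀ x : E, x ∈ principalIdeal e → MemLp (J x) ∞ μ := by
    rintro x ⟨c, hc, hx⟩
    refine memLp_top_of_bound (Lp.aestronglyMeasurable _) c ?_
    have h1 : |J x| ≤ J (c • e) := by rw [← habs]; exact (hle _ _).2 hx
    rw [← Lp.coeFn_le] at h1
    filter_upwards [h1, Lp.coeFn_abs (J x), hsmul c] with t h1 h2 h3
    rw [h2, h3] at h1
    exact h1
  exact
  { isProbabilityMeasure := hμ
    toL1 := J.toLinearMap
    le_iff_le := hle
    linfty_subset := by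
      intro f hf
      set c := (eLpNorm f ∞ μ).toReal
      obtain ⟨hf1, hf2⟩ := hbd f c (hess f hf)
      have happ : ∀ n : ℕ, ∃ z, ‖J z - f‖ < (1 / 2) ^ n := fun n => by
        obtain ⟨z, hz⟩ := hdense.exists_dist_lt f (ε := (1 / 2) ^ n) (by positivity)
        exact ⟨z, by rwa [dist_comm, dist_eq_norm] at hz⟩
      choose z hz using happ
      -- Truncation to the order interval is contractive in `L¹` and fixes `f`, so it preserves the
      -- approximation rate.
      let x : ℕ → E := fun n => (z n ⊓ c • e) ⊔ (-(c • e))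
      have hc : -(c • e) ≤ c • e := (hle _ _).1 (hf1.trans hf2)
      have hxf : ∀ n, ‖J (x n) - f‖ ≤ (1 / 2) ^ n := by
        intro n
        have h1 : f = (f ⊓ J (c • e)) ⊔ J (-(c • e)) := by
          rw [inf_eq_left.2 hf2, sup_eq_left.2 hf1]
        conv_lhs => rw [h1]
        rw [hsup, hinf]
        exact (norm_sup_sub_sup_le_norm _ _ _).trans
          ((norm_inf_sub_inf_le_norm _ _ _).trans (hz n).le)
      refine hE.exists_limit_of_bounded hφ J hnorm (x := x) (a := -(c • e)) (b := c • e) (C := 2)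
        (fun n => le_sup_right) (fun n => sup_le inf_le_right hc) (fun n => ?_) ?_
      · have e1 : J (x (n + 1) - x n) = (J (x (n + 1)) - f) - (J (x n) - f) := by
          rw [map_sub]; abel
        rw [e1]
        refine (norm_sub_le _ _).trans ?_
        have h1 := hxf (n + 1)
        have h2 := hxf n
        have h3 : (0 : ℝ) ≤ (1 / 2) ^ n := by positivity
        rw [pow_succ] at h1
        linarith
      · rw [tendsto_iff_norm_sub_tendsto_zero]
        exact squeeze_zero (fun n => norm_nonneg _) hxf
          (tendsto_pow_atTop_nhds_zero_of_lt_one (by norm_num) (by norm_num))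
    dense_range := hdense
    dense_linfty := (hE.dense_principalIdeal he).mono hmem
    norm_toL1_le := fun x _ => by
      change ‖J x‖ ≤ ‖x‖
      rw [hnorm, ← norm_abs_eq_norm x]
      exact (le_abs_self _).trans (hφn _)
    norm_le_two_mul := by
      intro x hx
      obtain ⟨h1, h2⟩ := hbd _ _ (hess _ hx)
      have h3 := (hle _ _).1 h1
      have h4 := (hle _ _).1 h2
      set c := (eLpNorm (J x) ∞ μ).toReal
      have hc : 0 ≤ c := ENNReal.toReal_nonneg
      have h5 : |x| ≤ |c • e| := by
        rw [abs_of_nonneg (smul_nonneg hc he.1)]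
        exact sup_le h4 (neg_le.1 h3)
      calc ‖x‖ ≤ ‖c • e‖ := norm_le_norm_of_abs_le_abs h5
        _ = c * ‖e‖ := by rw [norm_smul, Real.norm_of_nonneg hc]
        _ ≤ 2 * c := by nlinarith }

end Representation

/-! ### Pointwise calculus and absolute continuity in a Köthe representation -/

section KotheSpace

variable {E : Type u} [NormedAddCommGroup E] [NormedSpace ℝ E] [Lattice E]
  {Ω : Type w} [MeasurableSpace Ω] {μ : Measure Ω}

namespace KotheRepresentation

variable (R : KotheRepresentation E μ)

theorem toL1_injective : Function.Injective R.toL1 := fun _ _ h =>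
  le_antisymm ((R.le_iff_le _ _).1 h.le) ((R.le_iff_le _ _).1 h.ge)

theorem eq_of_ae {x y : E} (h : R.toL1 x =ᵐ[μ] R.toL1 y) : x = y :=
  R.toL1_injective (Lp.ext h)

theorem exists_of_ae_bound {f : Ω → ℝ} (hf : AEStronglyMeasurable f μ) (c : ℝ)
    (hc : ∀ᵐ t ∂μ, ‖f t‖ ≤ c) : ∃ x, R.toL1 x =ᵐ[μ] f := by
  have := R.isProbabilityMeasure
  have h : MemLp f ∞ μ := memLp_top_of_bound hf c hc
  have h1 : MemLp f 1 μ := h.mono_exponent le_top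
  obtain ⟨x, hx⟩ := R.linfty_subset (h1.toLp f) ((memLp_congr_ae h1.coeFn_toLp).2 h)
  exact ⟨x, by rw [hx]; exact h1.coeFn_toLp⟩

theorem ae_bound_of_memLp {x : E} (hx : MemLp (R.toL1 x) ∞ μ) :
    ∃ c : ℝ, 0 ≤ c ∧ ∀ᵐ t ∂μ, ‖R.toL1 x t‖ ≤ c := by
  refine ⟨(eLpNorm (R.toL1 x) ∞ μ).toReal, ENNReal.toReal_nonneg, ?_⟩
  have hfin : eLpNorm (R.toL1 x) ∞ μ ≠ ∞ := hx.2.ne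
  rw [eLpNorm_exponent_top] at hfin ⊢
  filter_upwards [ae_le_eLpNormEssSup (f := R.toL1 x) (μ := μ)] with t ht
  rw [← toReal_enorm]
  exact ENNReal.toReal_mono hfin ht

theorem le_of_ae_le {x y : E} (h : R.toL1 x ≤ᵐ[μ] R.toL1 y) : x ≤ y :=
  (R.le_iff_le _ _).1 ((Lp.coeFn_le _ _).1 h)

theorem ae_le_of_le {x y : E} (h : x ≤ y) : R.toL1 x ≤ᵐ[μ] R.toL1 y :=
  (Lp.coeFn_le _ _).2 ((R.le_iff_le _ _).2 h)

theorem measurableSet_supp (x : E) : MeasurableSet (R.supp x) :=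
  (Lp.stronglyMeasurable (R.toL1 x)).measurable (measurableSet_singleton (0 : ℝ)).compl

variable [IsOrderedAddMonoid E]

/-- Since `L_∞ ⊆ E`, the lattice operations of `E` are the pointwise ones. -/
theorem toL1_sup (x y : E) : R.toL1 (x ⊔ y) = R.toL1 x ⊔ R.toL1 y := by
  have hge : R.toL1 x ⊔ R.toL1 y ≤ R.toL1 (x ⊔ y) :=
    sup_le ((R.le_iff_le _ _).2 le_sup_left) ((R.le_iff_le _ _).2 le_sup_right)
  set g := R.toL1 (x ⊔ y) - R.toL1 x ⊔ R.toL1 y with hg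
  have hg0 : 0 ≤ g := sub_nonneg.2 hge
  have hg0' : ∀ᵐ t ∂μ, 0 ≤ g t := by
    filter_upwards [(Lp.coeFn_nonneg g).2 hg0] with t ht using ht
  -- The truncation of the defect `g` is bounded, hence in `E`. Subtracting it from `x ⊔ y` still
  -- leaves an upper bound of `x` and `y`, so it must vanish.
  obtain ⟨w, hw⟩ := R.exists_of_ae_bound (f := fun t => min (g t) 1)
    ((Lp.aestronglyMeasurable g).inf aestronglyMeasurable_const) 1 (by
      filter_upwards [hg0'] with t ht
      rw [Real.norm_of_nonneg (le_min ht zero_le_one)]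
      exact min_le_right _ _)
  have hwg : R.toL1 w ≤ g := by
    rw [← Lp.coeFn_le]
    filter_upwards [hw] with t ht
    rw [ht]; exact min_le_left _ _
  have h1 : R.toL1 x ⊔ R.toL1 y ≤ R.toL1 (x ⊔ y - w) := by
    rw [map_sub]
    exact le_sub_comm.1 hwg
  have h2 : x ⊔ y ≤ x ⊔ y - w := sup_le ((R.le_iff_le _ _).1 (le_sup_left.trans h1))
    ((R.le_iff_le _ _).1 (le_sup_right.trans h1))
  have h3 : w ≤ 0 := by simpa using h2
  have h4 := R.ae_le_of_le h3
  have h5 : g = 0 := by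
    refine Lp.ext ?_
    rw [map_zero] at h4
    filter_upwards [h4, hw, hg0', Lp.coeFn_zero ℝ 1 μ] with t h4 h5 h6 h7
    rw [h5, h7, Pi.zero_apply] at h4
    rw [h7, Pi.zero_apply]
    rcases min_le_iff.1 h4 with h | h
    · exact le_antisymm h h6
    · norm_num at h
  exact sub_eq_zero.1 h5

theorem toL1_abs (x : E) : R.toL1 |x| = |R.toL1 x| := by
  change R.toL1 (x ⊔ -x) = R.toL1 x ⊔ - R.toL1 x
  rw [toL1_sup, map_neg]

theorem toL1_abs_ae (x : E) : R.toL1 |x| =ᵐ[μ] fun t => |R.toL1 x t| := by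
  rw [toL1_abs]; exact Lp.coeFn_abs _

theorem abs_le_abs_of_ae {x y : E} (h : ∀ᵐ t ∂μ, |R.toL1 x t| ≤ |R.toL1 y t|) : |x| ≤ |y| := by
  refine R.le_of_ae_le ?_
  filter_upwards [h, R.toL1_abs_ae x, R.toL1_abs_ae y] with t h h1 h2
  rwa [h1, h2]

theorem disjoint_iff_ae {x y : E} :
    |x| ⊓ |y| = 0 ↔ ∀ᵐ t ∂μ, R.toL1 x t = 0 ∨ R.toL1 y t = 0 := by
  have hinf : R.toL1 (|x| ⊓ |y|) =ᵐ[μ] fun t => min |R.toL1 x t| |R.toL1 y t| := by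
    have h : R.toL1 (|x| ⊓ |y|) = |R.toL1 x| ⊓ |R.toL1 y| := by
      have h1 := R.toL1_sup (-|x|) (-|y|)
      rw [← neg_inf, map_neg, map_neg, map_neg, ← neg_inf, toL1_abs, toL1_abs] at h1
      exact neg_injective h1
    rw [h]
    filter_upwards [Lp.coeFn_inf |R.toL1 x| |R.toL1 y|, Lp.coeFn_abs (R.toL1 x),
      Lp.coeFn_abs (R.toL1 y)] with t h1 h2 h3
    rw [h1, Pi.inf_apply, h2, h3]
  have hmin : ∀ a b : ℝ, min |a| |b| = 0 ↔ a = 0 ∨ b = 0 := by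
    intro a b
    constructor
    · intro h
      rcases min_choice |a| |b| with h' | h'
      · left; rw [h'] at h; exact abs_eq_zero.1 h
      · right; rw [h'] at h; exact abs_eq_zero.1 h
    · rintro (rfl | rfl) <;> simp
  constructor
  · intro h
    rw [h, map_zero] at hinf
    filter_upwards [hinf, Lp.coeFn_zero ℝ 1 μ] with t h1 h2
    rw [h2] at h1
    exact (hmin _ _).1 h1.symm
  · intro h
    refine R.eq_of_ae ?_
    rw [map_zero]
    filter_upwards [hinf, Lp.coeFn_zero ℝ 1 μ, h] with t h1 h2 h3
    rw [h1, h2]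
    exact (hmin _ _).2 h3

variable [HasSolidNorm E] [CompleteSpace E]

theorem norm_le_norm_of_ae {x y : E} (h : ∀ᵐ t ∂μ, |R.toL1 x t| ≤ |R.toL1 y t|) : ‖x‖ ≤ ‖y‖ :=
  norm_le_norm_of_abs_le_abs (R.abs_le_abs_of_ae h)

variable [IsOrderedModule ℝ E]

/-- A positive operator on a Banach lattice is bounded; this gives the continuity of the inclusion
of `E` into `L_1`. -/
theorem exists_norm_toL1_le : ∃ C : ℝ, ∀ x, ‖R.toL1 x‖ ≤ C * ‖x‖ := by
  by_contra! hcon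
  have h1 : ∀ n : ℕ, ∃ x, 0 ≤ x ∧ ‖x‖ = 1 ∧ (4 : ℝ) ^ n < ‖R.toL1 x‖ := by
    intro n
    obtain ⟨x, hx⟩ := hcon (4 ^ n)
    have hx0 : 0 < ‖x‖ := by
      rw [norm_pos_iff]
      rintro rfl
      simp at hx
    refine ⟨‖x‖⁻¹ • |x|, smul_nonneg (by positivity) (abs_nonneg x), ?_, ?_⟩
    · rw [norm_smul, norm_abs_eq_norm, norm_inv, norm_norm, inv_mul_cancel₀ hx0.ne']
    · rw [map_smul, norm_smul, toL1_abs, norm_abs_eq_norm, norm_inv, norm_norm,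
        ← div_eq_inv_mul, lt_div_iff₀ hx0]
      exact hx
  choose x hx0 hx1 hx using h1
  -- The weights `2⁻ⁿ` are summable, but against images of norm above `4ⁿ` they make `‖R.toL1 y‖`
  -- exceed every `2ⁿ`.
  have hs : Summable fun n => ((1 / 2 : ℝ) ^ n) • x n := by
    refine Summable.of_norm_bounded summable_geometric_two fun n => ?_
    rw [norm_smul, hx1, mul_one, Real.norm_of_nonneg (by positivity)]
  set y := ∑' n, ((1 / 2 : ℝ) ^ n) • x n
  have hle : ∀ n, ((1 / 2 : ℝ) ^ n) • x n ≤ y := fun n =>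
    hs.le_tsum n fun m _ => smul_nonneg (by positivity) (hx0 m)
  have hb : ∀ n : ℕ, (2 : ℝ) ^ n ≤ ‖R.toL1 y‖ := by
    intro n
    have h1 : ‖R.toL1 (((1 / 2 : ℝ) ^ n) • x n)‖ ≤ ‖R.toL1 y‖ := by
      refine norm_le_norm_of_nonneg_of_le ?_ ((R.le_iff_le _ _).2 (hle n))
      rw [← map_zero R.toL1, R.le_iff_le]
      exact smul_nonneg (by positivity) (hx0 n)
    rw [map_smul, norm_smul, Real.norm_of_nonneg (by positivity)] at h1
    refine le_trans ?_ h1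
    calc (2 : ℝ) ^ n = (1 / 2) ^ n * 4 ^ n := by rw [← mul_pow]; norm_num
      _ ≤ _ := by gcongr; exact (hx n).le
  obtain ⟨n, hn⟩ := pow_unbounded_of_one_lt ‖R.toL1 y‖ (one_lt_two (α := ℝ))
  exact absurd (hb n) (not_le.2 hn)

theorem continuous_toL1 : Continuous R.toL1 := by
  obtain ⟨C, hC⟩ := R.exists_norm_toL1_le
  exact (R.toL1.mkContinuous C hC).continuous

/-- For bounded functions this is `L_∞ ⊆ E`. Solidity of the norm makes the restrictions of bounded
approximants Cauchy, and continuity of `toL1` identifies the limit. -/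
theorem exists_indicator {A : Set Ω} (hA : MeasurableSet A) (x : E) :
    ∃ w, R.toL1 w =ᵐ[μ] A.indicator (R.toL1 x) := by
  obtain ⟨b, hb, hbx⟩ := mem_closure_iff_seq_limit.1 (R.dense_linfty x)
  have hw : ∀ n, ∃ w, R.toL1 w =ᵐ[μ] A.indicator (R.toL1 (b n)) := fun n => by
    obtain ⟨c, hc0, hc⟩ := R.ae_bound_of_memLp (hb n)
    refine R.exists_of_ae_bound ((Lp.aestronglyMeasurable _).indicator hA) c ?_
    filter_upwards [hc] with t ht
    exact (norm_indicator_le_norm_self _ _).trans ht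
  choose w hw using hw
  have hle : ∀ n m, ‖w n - w m‖ ≤ ‖b n - b m‖ := by
    intro n m
    refine R.norm_le_norm_of_ae ?_
    rw [map_sub, map_sub]
    filter_upwards [Lp.coeFn_sub (R.toL1 (w n)) (R.toL1 (w m)),
      Lp.coeFn_sub (R.toL1 (b n)) (R.toL1 (b m)), hw n, hw m] with t h1 h2 h3 h4
    rw [h1, h2, Pi.sub_apply, Pi.sub_apply, h3, h4]
    by_cases ht : t ∈ A <;> simp [ht]
  have hc : CauchySeq w := by
    rw [Metric.cauchySeq_iff]
    intro ε hε
    obtain ⟨N, hN⟩ := Metric.cauchySeq_iff.1 hbx.cauchySeq ε hε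
    refine ⟨N, fun m hm n hn => lt_of_le_of_lt ?_ (hN m hm n hn)⟩
    rw [dist_eq_norm, dist_eq_norm]
    exact hle m n
  obtain ⟨z, hz⟩ := cauchySeq_tendsto_of_complete hc
  refine ⟨z, ?_⟩
  have hm : MemLp (A.indicator (R.toL1 x)) 1 μ := (Lp.memLp (R.toL1 x)).indicator hA
  suffices h : R.toL1 z = hm.toLp _ by rw [h]; exact hm.coeFn_toLp
  refine tendsto_nhds_unique ((R.continuous_toL1.tendsto z).comp hz) ?_
  rw [tendsto_iff_norm_sub_tendsto_zero]
  refine squeeze_zero (fun n => norm_nonneg _) (fun n => ?_)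
    (tendsto_iff_norm_sub_tendsto_zero.1 ((R.continuous_toL1.tendsto x).comp hbx))
  refine Lp.norm_le_norm_of_ae_le ?_
  simp only [Function.comp_apply]
  filter_upwards [Lp.coeFn_sub (R.toL1 (w n)) (hm.toLp _),
    Lp.coeFn_sub (R.toL1 (b n)) (R.toL1 x), hw n, hm.coeFn_toLp] with t h1 h2 h3 h4
  rw [h1, h2, Pi.sub_apply, Pi.sub_apply, h3, h4]
  by_cases ht : t ∈ A <;> simp [ht]

/-- Multiplication by the indicator function of a measurable set. -/
theorem exists_restrict {A : Set Ω} (hA : MeasurableSet A) :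
    ∃ P : E →L[ℝ] E, (∀ x, R.toL1 (P x) =ᵐ[μ] A.indicator (R.toL1 x)) ∧ ∀ x, ‖P x‖ ≤ ‖x‖ := by
  choose f hf using R.exists_indicator hA
  have hn : ∀ x, ‖f x‖ ≤ ‖x‖ := fun x => R.norm_le_norm_of_ae (by
    filter_upwards [hf x] with t ht
    rw [ht]
    exact norm_indicator_le_norm_self (R.toL1 x) t)
  let L : E →ₗ[ℝ] E :=
    { toFun := f
      map_add' := fun x y => by
        refine R.eq_of_ae ?_
        rw [map_add]
        have h0 := hf (x + y)
        rw [map_add] at h0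
        filter_upwards [h0, hf x, hf y, Lp.coeFn_add (R.toL1 (f x)) (R.toL1 (f y)),
          Lp.coeFn_add (R.toL1 x) (R.toL1 y)] with t h0 h1 h2 h3 h4
        rw [Pi.add_apply] at h3 h4
        rw [h0, h3, h1, h2]
        by_cases ht : t ∈ A
        · simpa only [Set.indicator_of_mem ht] using h4
        · simp [ht]
      map_smul' := fun c x => by
        refine R.eq_of_ae ?_
        rw [RingHom.id_apply, map_smul]
        have h0 := hf (c • x)
        rw [map_smul] at h0
        filter_upwards [h0, hf x, Lp.coeFn_smul c (R.toL1 (f x)),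
          Lp.coeFn_smul c (R.toL1 x)] with t h0 h1 h3 h4
        rw [Pi.smul_apply] at h3 h4
        rw [h0, h3, h1]
        by_cases ht : t ∈ A
        · simpa only [Set.indicator_of_mem ht] using h4
        · simp [ht] }
  exact ⟨L.mkContinuous 1 fun x => (hn x).trans_eq (one_mul _).symm, hf, hn⟩

theorem tendsto_indicator_zero (hE : OrderContinuousNorm E) {B : ℕ → Set Ω} (hB : Antitone B)
    (h0 : ∀ᵐ t ∂μ, ∃ n, t ∉ B n) {w : ℕ → E}
    (hw : ∀ n, R.toL1 (w n) =ᵐ[μ] (B n).indicator fun _ => 1) : Tendsto w atTop (𝓝 0) := by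
  have hw0 : ∀ n, 0 ≤ w n := fun n => R.le_of_ae_le (by
    rw [map_zero]
    filter_upwards [hw n, Lp.coeFn_zero ℝ 1 μ] with t h1 h2
    rw [h1, h2]
    exact Set.indicator_nonneg (fun _ _ => zero_le_one) t)
  have hanti : Antitone w := fun n m hnm => R.le_of_ae_le (by
    filter_upwards [hw n, hw m] with t h1 h2
    rw [h1, h2]
    exact Set.indicator_le_indicator_of_subset (hB hnm) (fun _ => zero_le_one) t)
  obtain ⟨z, hz⟩ := hE.tendsto_of_antitone hanti hw0
  have hz0 : 0 ≤ z := ge_of_tendsto' hz hw0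
  have hzw : ∀ n, z ≤ w n := hanti.le_of_tendsto hz
  have hz1 : z ≤ 0 := R.le_of_ae_le (by
    rw [map_zero]
    filter_upwards [ae_all_iff.2 fun n => R.ae_le_of_le (hzw n), ae_all_iff.2 hw, h0,
      Lp.coeFn_zero ℝ 1 μ] with t h1 h2 h3 h4
    obtain ⟨n, hn⟩ := h3
    have := h1 n
    rw [h2 n, Set.indicator_of_notMem hn] at this
    rw [h4]
    exact this)
  rwa [le_antisymm hz1 hz0] at hz

/-- Borel-Cantelli: a counterexample yields sets of summable measure; the indicators of their tail
unions decrease to zero in order, hence in norm. -/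
theorem exists_norm_indicator_le (hE : OrderContinuousNorm E) {ε : ℝ} (hε : 0 < ε) :
    ∃ δ : ℝ, 0 < δ ∧ ∀ A, MeasurableSet A → μ A ≤ ENNReal.ofReal δ →
      ∀ w, (R.toL1 w =ᵐ[μ] A.indicator fun _ => 1) → ‖w‖ ≤ ε := by
  by_contra! hcon
  choose A hA hμA w hw hwε using fun n : ℕ => hcon ((1 / 2) ^ n) (by positivity)
  have hsum : ∑' n, μ (A n) ≠ ∞ := by
    refine ne_top_of_le_ne_top ?_ (ENNReal.tsum_le_tsum hμA)
    rw [← ENNReal.ofReal_tsum_of_nonneg (fun n => by positivity) summable_geometric_two]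
    exact ENNReal.ofReal_ne_top
  let B : ℕ → Set Ω := fun n => ⋃ m ≥ n, A m
  have hBm : ∀ n, MeasurableSet (B n) := fun n =>
    MeasurableSet.iUnion fun m => MeasurableSet.iUnion fun _ => hA m
  have hB : Antitone B := fun n m hnm =>
    Set.biUnion_subset_biUnion_left fun k hk => le_trans hnm hk
  have h0 : ∀ᵐ t ∂μ, ∃ n, t ∉ B n := by
    filter_upwards [ae_eventually_notMem hsum] with t ht
    obtain ⟨n, hn⟩ := eventually_atTop.1 ht
    exact ⟨n, by simpa [B] using hn⟩
  choose v hv using fun n => R.exists_of_ae_bound (f := (B n).indicator fun _ => (1 : ℝ))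
    (aestronglyMeasurable_const.indicator (hBm n)) 1 (Eventually.of_forall fun t =>
      (norm_indicator_le_norm_self _ _).trans (by simp))
  have hlim := (R.tendsto_indicator_zero hE hB h0 hv).norm
  rw [norm_zero] at hlim
  obtain ⟨n, hn⟩ := (hlim.eventually (gt_mem_nhds hε)).exists
  have hle : ‖w n‖ ≤ ‖v n‖ := R.norm_le_norm_of_ae (by
    filter_upwards [hw n, hv n] with t h1 h2
    rw [h1, h2]
    by_cases ht : t ∈ A n
    · have : t ∈ B n := Set.mem_biUnion (le_refl n) ht
      simp [ht, this]
    · simp [ht])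
  linarith [hwε n]

/-- The norm of every element of `E` is absolutely continuous with respect to `μ`. -/
theorem exists_norm_restrict_le (hE : OrderContinuousNorm E) (x : E) {ε : ℝ} (hε : 0 < ε) :
    ∃ δ : ℝ, 0 < δ ∧ ∀ A, MeasurableSet A → μ A ≤ ENNReal.ofReal δ →
      ∀ w, (R.toL1 w =ᵐ[μ] A.indicator (R.toL1 x)) → ‖w‖ ≤ ε := by
  obtain ⟨b, hb, hbx⟩ := Metric.mem_closure_iff.1 (R.dense_linfty x) (ε / 2) (by positivity)
  obtain ⟨c, hc0, hc⟩ := R.ae_bound_of_memLp hb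
  -- The `+ 1` allows `c = 0`.
  obtain ⟨δ, hδ, h⟩ := R.exists_norm_indicator_le hE (ε := ε / (2 * (c + 1))) (by positivity)
  refine ⟨δ, hδ, fun A hA hμA w hw => ?_⟩
  obtain ⟨P, hP, hPn⟩ := R.exists_restrict hA
  obtain ⟨v, hv⟩ := R.exists_of_ae_bound (f := A.indicator fun _ => (1 : ℝ))
    (aestronglyMeasurable_const.indicator hA) 1 (Eventually.of_forall fun t =>
      (norm_indicator_le_norm_self _ _).trans (by simp))
  have hwP : w = P x := R.eq_of_ae (hw.trans (hP x).symm)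
  have hPb : ‖P b‖ ≤ ‖c • v‖ := R.norm_le_norm_of_ae (by
    rw [map_smul]
    filter_upwards [hP b, hv, Lp.coeFn_smul c (R.toL1 v), hc] with t h1 h2 h3 h4
    rw [h1, h3, Pi.smul_apply, h2]
    by_cases ht : t ∈ A
    · simpa [ht, abs_of_nonneg hc0] using h4
    · simp [ht])
  have hv' := h A hA hμA v hv
  have h1 : ‖c • v‖ ≤ ε / 2 := by
    rw [norm_smul, Real.norm_of_nonneg hc0]
    calc c * ‖v‖ ≤ (c + 1) * (ε / (2 * (c + 1))) := by gcongr; linarith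
      _ = ε / 2 := by field_simp
  have h2 : ‖P (x - b)‖ ≤ ε / 2 := (hPn _).trans (by rw [← dist_eq_norm]; exact hbx.le)
  have e1 : w = P (x - b) + P b := by rw [map_sub, sub_add_cancel, hwP]
  rw [e1]
  exact (norm_add_le _ _).trans (by linarith)

end KotheRepresentation

end KotheSpace

/-! ### Strict singularity from summable images -/

section CoordinateProjections

variable {X : Type u} {Y : Type v} [NormedAddCommGroup X] [NormedSpace ℝ X]
  [NormedAddCommGroup Y] [NormedSpace ℝ Y]

theorem map_linearCombination_of_biorthogonal {y : ℕ → X} {P : ℕ → X →L[ℝ] X}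
    (hP : ∀ n, P n (y n) = y n) (hP' : ∀ n m, m ≠ n → P n (y m) = 0) (c : ℕ →₀ ℝ) (n : ℕ) :
    P n (c.sum fun i a => a • y i) = c n • y n := by
  rw [Finsupp.sum, map_sum, Finset.sum_eq_single n]
  · rw [map_smul, hP]
  · intro m _ hm
    rw [map_smul, hP' n m hm, smul_zero]
  · intro hn
    rw [Finsupp.notMem_support_iff.1 hn, zero_smul, map_zero]

theorem linearIndependent_of_biorthogonal {y : ℕ → X} {P : ℕ → X →L[ℝ] X} (hy : ∀ n, y n ≠ 0)
    (hP : ∀ n, P n (y n) = y n) (hP' : ∀ n m, m ≠ n → P n (y m) = 0) :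
    LinearIndependent ℝ y := by
  rw [linearIndependent_iff]
  intro c hc
  ext n
  have h := map_linearCombination_of_biorthogonal hP hP' c n
  rw [Finsupp.linearCombination_apply] at hc
  rw [hc, map_zero] at h
  exact (smul_eq_zero.1 h.symm).resolve_right (hy n)

/-- An operator whose values on a seminormalized sequence with contractive coordinate projections
are summable is strictly singular on the closed span. -/
theorem isStrictlySingular_of_summable (T : X →L[ℝ] Y) {y : ℕ → X} {P : ℕ → X →L[ℝ] X}
    (hP : ∀ n, P n (y n) = y n) (hP' : ∀ n m, m ≠ n → P n (y m) = 0)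
    (hPn : ∀ n x, ‖P n x‖ ≤ ‖x‖) (hy : ∀ n, 1 / 2 ≤ ‖y n‖) (hT : Summable fun n => ‖T (y n)‖) :
    IsStrictlySingular (T.comp (closedSpan y).subtypeL) := by
  rintro ⟨M, -, hM, c, hc, hcM⟩
  -- Coefficients are at most `2 * ‖z‖` because `‖y n‖ ≥ 1 / 2`, so a tail `c / 4` of the images
  -- gives the error `c / 2 * ‖z‖`.
  obtain ⟨s, hs⟩ := summable_iff_vanishing_norm.1 hT (c / 4) (by positivity)
  let Q : X →L[ℝ] X := ∑ n ∈ s, P n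
  let F : Submodule ℝ X := Submodule.span ℝ (y '' s)
  have hF : FiniteDimensional ℝ F := FiniteDimensional.span_of_finite ℝ (s.finite_toSet.image y)
  have hspan : ∀ z ∈ Submodule.span ℝ (Set.range y),
      Q z ∈ F ∧ ‖T z - T (Q z)‖ ≤ c / 2 * ‖z‖ := by
    intro z hz
    obtain ⟨a, rfl⟩ := Finsupp.mem_span_range_iff_exists_finsupp.1 hz
    set z := a.sum fun i b => b • y i with hzdef
    have hPz : ∀ n, P n z = a n • y n := map_linearCombination_of_biorthogonal hP hP' a
    have hQz : Q z = ∑ n ∈ s, a n • y n := by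
      simp only [Q, sum_apply]
      exact Finset.sum_congr rfl fun n _ => hPz n
    refine ⟨?_, ?_⟩
    · rw [hQz]
      exact sum_mem fun n hn => F.smul_mem _ (Submodule.subset_span ⟨n, hn, rfl⟩)
    · have ha : ∀ n, |a n| ≤ 2 * ‖z‖ := by
        intro n
        have h1 := hPn n z
        rw [hPz, norm_smul, Real.norm_eq_abs] at h1
        nlinarith [abs_nonneg (a n), hy n]
      have e1 : z - Q z = ∑ n ∈ a.support \ s, a n • y n := by
        rw [hQz, hzdef, Finsupp.sum, sub_eq_iff_eq_add]
        have h2 : ∑ n ∈ s, a n • y n = ∑ n ∈ a.support ∩ s, a n • y n := by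
          refine (Finset.sum_subset Finset.inter_subset_right fun n hn hn' => ?_).symm
          have : n ∉ a.support := fun h => hn' (Finset.mem_inter.2 ⟨h, hn⟩)
          rw [Finsupp.notMem_support_iff.1 this, zero_smul]
        rw [h2, add_comm, Finset.sum_inter_add_sum_sdiff]
      rw [← map_sub, e1, map_sum]
      have h3 := hs (a.support \ s) Finset.sdiff_disjoint
      rw [Real.norm_of_nonneg (Finset.sum_nonneg fun n _ => norm_nonneg _)] at h3
      calc _ ≤ ∑ n ∈ a.support \ s, ‖T (a n • y n)‖ := norm_sum_le _ _
        _ ≤ ∑ n ∈ a.support \ s, 2 * ‖z‖ * ‖T (y n)‖ := by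
          refine Finset.sum_le_sum fun n _ => ?_
          rw [map_smul, norm_smul, Real.norm_eq_abs]
          gcongr
          exact ha n
        _ = 2 * ‖z‖ * ∑ n ∈ a.support \ s, ‖T (y n)‖ := by rw [Finset.mul_sum]
        _ ≤ 2 * ‖z‖ * (c / 4) := by gcongr
        _ = c / 2 * ‖z‖ := by ring
  have hclosed : ∀ z ∈ closedSpan y, Q z ∈ F ∧ ‖T z - T (Q z)‖ ≤ c / 2 * ‖z‖ := by
    have hcl : IsClosed {z | Q z ∈ F ∧ ‖T z - T (Q z)‖ ≤ c / 2 * ‖z‖} :=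
      (F.closed_of_finiteDimensional.preimage Q.continuous).inter
        (isClosed_le (f := fun z => ‖T z - T (Q z)‖) (g := fun z => c / 2 * ‖z‖)
          (by fun_prop) (by fun_prop))
    exact fun z hz => closure_minimal (s := (Submodule.span ℝ (Set.range y) : Set X)) hspan hcl hz
  -- An infinite dimensional `M` contains a nonzero vector killed by the finite rank map `Q`; there
  -- `T` is too small for the lower bound `c`.
  let q : M →ₗ[ℝ] F := LinearMap.codRestrict F
    (Q.toLinearMap ∘ₗ (closedSpan y).subtype ∘ₗ M.subtype) fun z => (hclosed _ z.1.2).1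
  have hq : ¬ Function.Injective q := fun h => hM (FiniteDimensional.of_injective q h)
  rw [injective_iff_map_eq_zero] at hq
  push Not at hq
  obtain ⟨z, hz, hz0⟩ := hq
  have hQ : Q (z : X) = 0 := congrArg Subtype.val hz
  have h1 := (hclosed _ z.1.2).2
  rw [hQ, map_zero, sub_zero] at h1
  have h2 : c * ‖(z : X)‖ ≤ ‖T (z : X)‖ := hcM z
  have h3 : 0 < ‖(z : X)‖ := by
    rw [norm_pos_iff]
    intro h
    exact hz0 (Subtype.ext (Subtype.ext h))
  nlinarith

end CoordinateProjections

/-! ### Disjoint sequences and vectors of small support -/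

section DisjointlyNonSingular

variable {E : Type u} [NormedAddCommGroup E] [NormedSpace ℝ E] [CompleteSpace E]
  [Lattice E] [IsOrderedAddMonoid E] [IsOrderedModule ℝ E] [HasSolidNorm E]
  {Ω : Type w} [MeasurableSpace Ω] {μ : Measure Ω}
  {Y : Type v} [NormedAddCommGroup Y] [NormedSpace ℝ Y]

namespace KotheRepresentation

variable (R : KotheRepresentation E μ)

theorem eq_self_of_ae {A : Set Ω} {P : E →L[ℝ] E}
    (hP : ∀ x, R.toL1 (P x) =ᵐ[μ] A.indicator (R.toL1 x)) {x : E}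
    (hx : ∀ᵐ t ∂μ, t ∉ A → R.toL1 x t = 0) : P x = x := by
  refine R.eq_of_ae ?_
  filter_upwards [hP x, hx] with t h1 h2
  rw [h1]
  by_cases ht : t ∈ A
  · simp [ht]
  · simp [ht, h2 ht]

theorem eq_zero_of_ae {A : Set Ω} {P : E →L[ℝ] E}
    (hP : ∀ x, R.toL1 (P x) =ᵐ[μ] A.indicator (R.toL1 x)) {x : E}
    (hx : ∀ᵐ t ∂μ, t ∈ A → R.toL1 x t = 0) : P x = 0 := by
  refine R.eq_of_ae ?_
  rw [map_zero]
  filter_upwards [hP x, hx, Lp.coeFn_zero ℝ 1 μ] with t h1 h2 h3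
  rw [h1, h3]
  by_cases ht : t ∈ A
  · simp [ht, h2 ht]
  · simp [ht]

/-- The coordinate projections associated with a disjoint sequence. -/
theorem exists_coordinate_projections (R : KotheRepresentation E μ) {x : ℕ → E} (hx : IsDisjointSeq x) :
    ∃ P : ℕ → E →L[ℝ] E, (∀ n, P n (x n) = x n) ∧ (∀ n m, m ≠ n → P n (x m) = 0) ∧
      ∀ n z, ‖P n z‖ ≤ ‖z‖ := by
  choose P hP hPn using fun n => R.exists_restrict (R.measurableSet_supp (x n))
  refine ⟨P, fun n => ?_, fun n m hmn => ?_, hPn⟩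
  · exact R.eq_self_of_ae (hP n) (Eventually.of_forall fun t ht => not_not.1 ht)
  · refine R.eq_zero_of_ae (hP n) ?_
    filter_upwards [R.disjoint_iff_ae.1 (hx.2 m n hmn)] with t ht h
    exact ht.resolve_right h

/-- Disjoint supports have summable measures, so every vector in the closed span of a tail is
supported in a set of measure less than `r`, and the hypothesis applies after normalization. -/
theorem isDisjointlyNonSingular_of_bound (T : E →L[ℝ] Y) {r : ℝ} (hr : 0 < r)
    (h : ∀ x : E, ‖x‖ = 1 → μ.real (R.supp x) < r → r < ‖T x‖) : IsDisjointlyNonSingular T := by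
  have := R.isProbabilityMeasure
  rintro ⟨x, hx, hsing⟩
  have hdisj : Pairwise fun m n => AEDisjoint μ (R.supp (x m)) (R.supp (x n)) := by
    intro m n hmn
    have h1 := R.disjoint_iff_ae.1 (hx.2 m n hmn)
    rw [AEDisjoint, measure_eq_zero_iff_ae_notMem]
    filter_upwards [h1] with t ht h2
    exact ht.elim h2.1 h2.2
  have hsum : ∑' n, μ (R.supp (x n)) ≠ ∞ := by
    rw [← measure_iUnion₀ hdisj fun n => (R.measurableSet_supp _).nullMeasurableSet]
    exact measure_ne_top _ _
  obtain ⟨N, hN⟩ := ((ENNReal.tendsto_sum_nat_add _ hsum).eventually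
    (gt_mem_nhds (ENNReal.ofReal_pos.2 hr))).exists
  let x' : ℕ → E := fun k => x (k + N)
  have hx' : IsDisjointSeq x' := ⟨fun n => hx.1 _, fun m n hmn => hx.2 _ _ (by omega)⟩
  let A : Set Ω := ⋃ k, R.supp (x' k)
  have hA : MeasurableSet A := MeasurableSet.iUnion fun k => R.measurableSet_supp _
  have hμA : μ.real A < r := by
    rw [measureReal_def]
    refine (ENNReal.toReal_lt_toReal (measure_ne_top _ _) ENNReal.ofReal_ne_top).2
      ((measure_iUnion_le _).trans_lt hN) |>.trans_eq (ENNReal.toReal_ofReal hr.le)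
  obtain ⟨P, hP, -⟩ := R.exists_restrict hA
  -- Being fixed by restriction to `A` is a closed linear condition, so it carries support
  -- information to the closure.
  have hfix : ∀ z ∈ closedSpan x', P z = z := by
    have hcl : IsClosed {z | P z = z} := isClosed_eq P.continuous continuous_id
    refine fun z hz => closure_minimal (s := (Submodule.span ℝ (Set.range x') : Set E)) ?_ hcl hz
    change Submodule.span ℝ (Set.range x') ≤
      LinearMap.eqLocus P.toLinearMap (LinearMap.id : E →ₗ[ℝ] E)
    rw [Submodule.span_le]
    rintro _ ⟨k, rfl⟩
    refine R.eq_self_of_ae hP (Eventually.of_forall fun t ht => ?_)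
    by_contra hne
    exact ht (Set.mem_iUnion.2 ⟨k, hne⟩)
  have hbound : ∀ z ∈ closedSpan x', r * ‖z‖ ≤ ‖T z‖ := by
    intro z hz
    rcases eq_or_ne z 0 with rfl | hz0
    · simp
    have hzn : 0 < ‖z‖ := norm_pos_iff.2 hz0
    have hw := (closedSpan x').smul_mem ‖z‖⁻¹ hz
    set w := ‖z‖⁻¹ • z
    have hw1 : ‖w‖ = 1 := by
      rw [norm_smul, norm_inv, norm_norm, inv_mul_cancel₀ hzn.ne']
    have hs : μ.real (R.supp w) ≤ μ.real A := by
      refine ENNReal.toReal_mono (measure_ne_top _ _) (measure_mono_ae ?_)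
      have h1 := hP w
      rw [hfix w hw] at h1
      filter_upwards [h1] with t ht hne
      by_contra hnA
      exact hne (ht.trans (Set.indicator_of_notMem (s := A) hnA _))
    have h2 := h w hw1 (hs.trans_lt hμA)
    rw [map_smul, norm_smul, norm_inv, norm_norm, ← div_eq_inv_mul, lt_div_iff₀ hzn] at h2
    exact h2.le
  have hle : closedSpan x' ≤ closedSpan x :=
    Submodule.topologicalClosure_mono (Submodule.span_mono (by
      rintro _ ⟨k, rfl⟩; exact ⟨_, rfl⟩))
  refine hsing ⟨(closedSpan x').comap (closedSpan x).subtype, ?_, fun hfin => ?_, r, hr, ?_⟩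
  · exact (Submodule.isClosed_topologicalClosure _).preimage continuous_subtype_val
  · obtain ⟨Q, hQ, hQ', -⟩ := R.exists_coordinate_projections hx'
    have hli := linearIndependent_of_biorthogonal hx'.1 hQ hQ'
    have hmem : ∀ k, x' k ∈ closedSpan x' := fun k =>
      Submodule.le_topologicalClosure _ (Submodule.subset_span ⟨k, rfl⟩)
    let v : ℕ → (closedSpan x').comap (closedSpan x).subtype := fun k =>
      ⟨⟨x' k, hle (hmem k)⟩, hmem k⟩
    have hv : LinearIndependent ℝ v :=
      LinearIndependent.of_comp ((closedSpan x).subtype ∘ₗ Submodule.subtype _) hli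
    exact Module.Finite.not_linearIndependent_of_infinite v hv
  · intro z
    exact hbound _ z.2

/-- If there are normalized vectors with small support and small image, then perturbing them gives
a disjoint sequence with rapidly decreasing images. -/
theorem exists_disjointSeq (hE : OrderContinuousNorm E) (T : E →L[ℝ] Y)
    (h : ∀ r : ℝ, 0 < r → ∃ x : E, ‖x‖ = 1 ∧ μ.real (R.supp x) < r ∧ ‖T x‖ ≤ r) :
    ∃ y : ℕ → E, IsDisjointSeq y ∧ (∀ n, 1 / 2 ≤ ‖y n‖) ∧ Summable fun n => ‖T (y n)‖ := by
  have := R.isProbabilityMeasure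
  have hstep : ∀ η : ℝ, 0 < η → ∃ (x : E) (δ : ℝ), ‖x‖ = 1 ∧ μ.real (R.supp x) < η / 2 ∧
      ‖T x‖ ≤ η / 2 ∧ 0 < δ ∧ ∀ A, MeasurableSet A → μ A ≤ ENNReal.ofReal δ →
        ∀ w, (R.toL1 w =ᵐ[μ] A.indicator (R.toL1 x)) → ‖w‖ ≤ η / 2 := by
    intro η hη
    obtain ⟨x, h1, h2, h3⟩ := h (η / 2) (by positivity)
    obtain ⟨δ, hδ, h4⟩ := R.exists_norm_restrict_le hE x (ε := η / 2) (by positivity)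
    exact ⟨x, δ, h1, h2, h3, hδ, h4⟩
  choose! X D hX1 hXs hXT hD hXD using hstep
  -- Each tolerance is at most half the preceding one and at most the absolute continuity modulus
  -- `D` of the preceding vector.
  let η : ℕ → ℝ := fun n => Nat.rec 1 (fun _ a => min (a / 2) (D a)) n
  have hη1 : ∀ n, η (n + 1) = min (η n / 2) (D (η n)) := fun n => rfl
  have hη : ∀ n, 0 < η n := by
    intro n
    induction n with
    | zero => exact one_pos
    | succ n ih => rw [hη1]; exact lt_min (by positivity) (hD _ ih)
  have hηpow : ∀ k j, η (k + j) ≤ η k * (1 / 2) ^ j := by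
    intro k j
    induction j with
    | zero => simp
    | succ j ih =>
      rw [← add_assoc, hη1, pow_succ]
      have := min_le_left (η (k + j) / 2) (D (η (k + j)))
      linarith
  have hηle : ∀ n, η n ≤ (1 / 2) ^ n := fun n => by
    have := hηpow 0 n
    rwa [zero_add, show η 0 = 1 from rfl, one_mul] at this
  let x : ℕ → E := fun n => X (η n)
  let A : ℕ → Set Ω := fun k => ⋃ j, R.supp (x (k + 1 + j))
  have hA : ∀ k, MeasurableSet (A k) := fun k =>
    MeasurableSet.iUnion fun j => R.measurableSet_supp _
  -- All later supports together have measure at most `η (k + 1)`, because the `j`-th contributes at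
  -- most `η (k + 1) * (1 / 2) ^ j / 2`.
  have hμA : ∀ k, μ (A k) ≤ ENNReal.ofReal (D (η k)) := by
    intro k
    have hs : HasSum (fun j : ℕ => η (k + 1) * (1 / 2) ^ j / 2) (η (k + 1)) := by
      have := (hasSum_geometric_two.mul_left (η (k + 1))).div_const 2
      simpa using this
    calc μ (A k) ≤ ∑' j, μ (R.supp (x (k + 1 + j))) := measure_iUnion_le _
      _ ≤ ∑' j : ℕ, ENNReal.ofReal (η (k + 1) * (1 / 2) ^ j / 2) := by
        refine ENNReal.tsum_le_tsum fun j => ?_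
        rw [← ofReal_measureReal]
        refine ENNReal.ofReal_le_ofReal ((hXs _ (hη _)).le.trans ?_)
        have := hηpow (k + 1) j
        linarith
      _ = ENNReal.ofReal (η (k + 1)) := by
        rw [← ENNReal.ofReal_tsum_of_nonneg (fun j => ?_) hs.summable, hs.tsum_eq]
        have := hη (k + 1)
        positivity
      _ ≤ _ := ENNReal.ofReal_le_ofReal (min_le_right _ _)
  choose w hw using fun k => R.exists_indicator (hA k) (x k)
  have hwn : ∀ k, ‖w k‖ ≤ η k / 2 := fun k => hXD _ (hη k) _ (hA k) (hμA k) _ (hw k)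
  have hy : ∀ k, R.toL1 (x k - w k) =ᵐ[μ] (A k)ᶜ.indicator (R.toL1 (x k)) := by
    intro k
    rw [map_sub]
    filter_upwards [hw k, Lp.coeFn_sub (R.toL1 (x k)) (R.toL1 (w k))] with t h1 h2
    rw [h2, Pi.sub_apply, h1]
    by_cases ht : t ∈ A k <;> simp [ht]
  have hhalf : ∀ n, 1 / 2 ≤ ‖x n - w n‖ := by
    intro n
    have h1 := norm_sub_norm_le (x n) (w n)
    rw [hX1 _ (hη n)] at h1
    have h2 := hwn n
    have h3 := (hηle n).trans (pow_le_one₀ (by norm_num) (by norm_num))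
    linarith
  have hlt : ∀ m n, m < n → |x m - w m| ⊓ |x n - w n| = 0 := by
    intro m n hmn
    rw [R.disjoint_iff_ae]
    filter_upwards [hy m, hy n] with t h1 h2
    rw [h1, h2]
    by_cases ht : R.toL1 (x n) t = 0
    · right
      exact Set.indicator_apply_eq_zero.2 fun _ => ht
    · left
      have hmem : t ∈ A m := by
        refine Set.mem_iUnion.2 ⟨n - (m + 1), ?_⟩
        rw [show m + 1 + (n - (m + 1)) = n by omega]
        exact ht
      exact Set.indicator_of_notMem (Set.notMem_compl_iff.2 hmem) _
  refine ⟨fun n => x n - w n, ⟨fun n h0 => ?_, fun m n hmn => ?_⟩, hhalf, ?_⟩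
  · have := hhalf n
    rw [show x n - w n = 0 from h0, norm_zero] at this
    norm_num at this
  · rcases lt_or_gt_of_ne hmn with h1 | h1
    · exact hlt m n h1
    · rw [inf_comm]; exact hlt n m h1
  · refine Summable.of_nonneg_of_le (fun n => norm_nonneg _) (fun n => ?_)
      (summable_geometric_two.mul_left (1 + ‖T‖))
    rw [map_sub]
    have h1 := hXT _ (hη n)
    have h2 : ‖T (w n)‖ ≤ ‖T‖ * (η n / 2) := (T.le_opNorm _).trans (by gcongr; exact hwn n)
    have h3 := hηle n
    have h4 := hη n
    calc _ ≤ ‖T (x n)‖ + ‖T (w n)‖ := norm_sub_le _ _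
      _ ≤ (1 + ‖T‖) * η n := by nlinarith [norm_nonneg T]
      _ ≤ _ := by gcongr

theorem exists_bound_of_isDisjointlyNonSingular (hE : OrderContinuousNorm E) (T : E →L[ℝ] Y)
    (hT : IsDisjointlyNonSingular T) :
    ∃ r : ℝ, 0 < r ∧ ∀ x : E, ‖x‖ = 1 → μ.real (R.supp x) < r → r < ‖T x‖ := by
  by_contra! hcon
  obtain ⟨y, hy, hhalf, hs⟩ := R.exists_disjointSeq hE T hcon
  obtain ⟨P, hP, hP', hPn⟩ := R.exists_coordinate_projections hy
  exact hT ⟨y, hy, isStrictlySingular_of_summable T hP hP' hPn hhalf hs⟩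

end KotheRepresentation

end DisjointlyNonSingular

/-! ### The main theorem -/

theorem theorem3p1 {E : Type u} [NormedAddCommGroup E] [NormedSpace ℝ E] [CompleteSpace E]
    [Lattice E] [IsOrderedAddMonoid E] [IsOrderedModule ℝ E] [HasSolidNorm E] [Nontrivial E]
    (hE : OrderContinuousNorm E) (he : ∃ e : E, IsWeakUnit e)
    {Y : Type v} [NormedAddCommGroup Y] [NormedSpace ℝ Y] [CompleteSpace Y] (T : E →L[ℝ] Y) :
    (∃ (Ω : Type u) (_ : MeasurableSpace Ω) (μ : Measure Ω), Nonempty (KotheRepresentation E μ)) ∧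
    ∀ (Ω : Type w) [MeasurableSpace Ω] (μ : Measure Ω) (R : KotheRepresentation E μ),
      List.TFAE [
        IsDisjointlyNonSingular T,
        ∃ r : ℝ, 0 < r ∧ ∀ x : ℕ → E, (∀ n, ‖x n‖ = 1) →
          Tendsto (fun n => μ.real (R.supp (x n))) atTop (𝓝 0) →
            r < liminf (fun n => ‖T (x n)‖) atTop,
        ∀ x : ℕ → E, (∀ n, ‖x n‖ = 1) →
          Tendsto (fun n => μ.real (R.supp (x n))) atTop (𝓝 0) →
            0 < liminf (fun n => ‖T (x n)‖) atTop,
        ∃ r : ℝ, 0 < r ∧ ∀ x : E, ‖x‖ = 1 → μ.real (R.supp x) < r → r < ‖T x‖] := by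
  refine ⟨hE.exists_kotheRepresentation he, fun Ω _ μ R => ?_⟩
  tfae_have 4 → 1 := fun ⟨r, hr, h⟩ => R.isDisjointlyNonSingular_of_bound T hr h
  tfae_have 1 → 4 := R.exists_bound_of_isDisjointlyNonSingular hE T
  tfae_have 4 → 2 := by
    rintro ⟨r, hr, h⟩
    -- Strict inequalities only pass to `r ≤ liminf`, so the constant is halved.
    refine ⟨r / 2, by positivity, fun x hx hlim => lt_of_lt_of_le (half_lt_self hr) ?_⟩
    refine le_liminf_of_le ?_ ?_
    -- A real `liminf` is meaningful only with an upper bound, here `‖T‖`.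
    · refine IsBoundedUnder.isCoboundedUnder_ge ⟨‖T‖, eventually_map.2 (Eventually.of_forall ?_)⟩
      intro n
      simpa [hx n] using T.le_opNorm (x n)
    · filter_upwards [hlim.eventually (gt_mem_nhds hr)] with n hn
      exact (h (x n) (hx n) hn).le
  tfae_have 2 → 3 := fun ⟨r, hr, h⟩ x hx hlim => hr.trans (h x hx hlim)
  tfae_have 3 → 4 := by
    intro h
    by_contra! hcon
    choose x hx hs hT using fun n : ℕ => hcon (1 / ((n : ℝ) + 1)) (by positivity)
    have hlim : Tendsto (fun n : ℕ => 1 / ((n : ℝ) + 1)) atTop (𝓝 0) :=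
      tendsto_one_div_add_atTop_nhds_zero_nat
    have h1 := h x hx (squeeze_zero (fun n => measureReal_nonneg) (fun n => (hs n).le) hlim)
    have h2 : Tendsto (fun n => ‖T (x n)‖) atTop (𝓝 0) :=
      squeeze_zero (fun n => norm_nonneg _) hT hlim
    rw [h2.liminf_eq] at h1
    exact lt_irrefl _ h1
  tfae_finish
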